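/- Let $\varphi:\mathbb R^2\to[0,\infty)$ be an anisotropy, i.e. a convex, even function with $\varphi(tx)=t\varphi(x)$ for $t\ge 0$, such that $c_0|x|\le\varphi(x)\le c_0^{-1}|x|$ for all $x$ and some $c_0>0$ (no smoothness or strict convexity is assumed). Let $W_\varphi=\{\varphi\le 1\}$ be its Wulff shape, and let $\varphi^\circ(\nu)=\sup\{\nu\cdot x:\ \varphi(x)\le 1\}$ be its polar. For $E\subseteq\mathbb R^2$ let $$d^E_\varphi(x)=\inf_{y\in E}\varphi(x-y)-\inf_{y\notin E}\varphi(y-x)$$ be the signed $\varphi$-distance function to $\partial E$. For $R>0$, $E$ satisfies the inner $RW_\varphi$-condition if $$\overline E=\bigcup_{x:\ d^E_\varphi(x)\le -R}(x+RW_\varphi)$$ and, for all $0<r<R$ and $x\in\mathbb R^2$, the set $(x+rW_\varphi)\cap E^c$ is connected (possibly empty), where $E^c=\mathbb R^2\setminus E$. $E$ satisfies the $RW_\varphi$-condition if both $E$ and $E^c$ satisfy the inner $RW_\varphi$-condition. **Statement.** Let $E\subseteq\mathbb R^2$ satisfy the $RW_\varphi$-condition for some $R>0$. Then $E$ is $\varphi$-regular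 in the sense of Bellettini–Novaga, that is: on the set $U=\{x:\ |d^E_\varphi(x)|<R\}$ there exists a vector field $n_\varphi\in L^\infty(U;\mathbb R^2)$ such that $n_\varphi(x)\in\partial\varphi^\circ(\nabla d^E_\varphi(x))$ for almost every $x\in U$, where $\partial\varphi^\circ$ denotes the subdifferential (in particular $d^E_\varphi$ is differentiable at almost every point of $U$), and such that the distributional divergence of $n_\varphi$ in $U$ belongs to $L^\infty_{\rm loc}(U)$. (If $E=\emptyset$ or $E=\mathbb R^2$ there is no boundary and nothing is claimed.) -/

import Mathlib

open MeasureTheory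
open scoped ContDiff RealInnerProductSpace ENNReal

noncomputable section

/-- The Euclidean plane `ℝ²`. -/
abbrev Plane : Type := EuclideanSpace ℝ (Fin 2)

/-- An (even) anisotropy: a convex, one-homogeneous, even function on the plane which is
comparable with the Euclidean norm, `c₀ |x| ≤ φ x ≤ c₀⁻¹ |x|`. -/
structure IsAnisotropy (φ : Plane → ℝ) : Prop where
  convex : ConvexOn ℝ Set.univ φ
  homogeneous : ∀ t : ℝ, 0 ≤ t → ∀ x : Plane, φ (t • x) = t * φ x
  even : ∀ x : Plane, φ (-x) = φ x
  coercive : ∃ c₀ : ℝ, 0 < c₀ ∧ ∀ x : Plane, c₀ * ‖x‖ ≤ φ x ∧ φ x ≤ c₀⁻¹ * ‖x‖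

/-- The Wulff shape `W_φ = {φ ≤ 1}`. -/
def wulffShape (φ : Plane → ℝ) : Set Plane := {x | φ x ≤ 1}

/-- The scaled and translated Wulff shape `x + r W_φ`. -/
def wulffAt (φ : Plane → ℝ) (x : Plane) (r : ℝ) : Set Plane :=
  (fun w : Plane => x + r • w) '' wulffShape φ

/-- The polar `φ°(ν) = sup {ν · x : φ x ≤ 1}`. -/
def polarAnisotropy (φ : Plane → ℝ) (ν : Plane) : ℝ :=
  sSup ((fun x : Plane => ⟪ν, x⟫) '' wulffShape φ)

/-- The signed `φ`-distance function to `∂E`, negative inside `E` and positive outside: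
`d(x) = inf_{y ∈ E} φ(x - y) - inf_{y ∉ E} φ(y - x)`. -/
def phiSignedDist (φ : Plane → ℝ) (E : Set Plane) (x : Plane) : ℝ :=
  (⨅ y : E, φ (x - y)) - ⨅ y : (Eᶜ : Set Plane), φ (y - x)

/-- The inner `R W_φ`-condition. The empty set counts as connected. -/
def InnerWulffCondition (φ : Plane → ℝ) (R : ℝ) (E : Set Plane) : Prop :=
  closure E = (⋃ x ∈ {x : Plane | phiSignedDist φ E x ≤ -R}, wulffAt φ x R) ∧
    ∀ r : ℝ, 0 < r → r < R → ∀ x : Plane, IsPreconnected (wulffAt φ x r ∩ Eᶜ)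

/-- The outer `R W_φ`-condition: the inner one for the complement. -/
def OuterWulffCondition (φ : Plane → ℝ) (R : ℝ) (E : Set Plane) : Prop :=
  InnerWulffCondition φ R Eᶜ

/-- The `R W_φ`-condition: both the inner and the outer one. -/
def WulffCondition (φ : Plane → ℝ) (R : ℝ) (E : Set Plane) : Prop :=
  InnerWulffCondition φ R E ∧ OuterWulffCondition φ R E

/-- The subdifferential `∂f(x)` of a function `f` on the plane (used for convex `f`). -/
def subdiff (f : Plane → ℝ) (x : Plane) : Set Plane :=
  {p | ∀ y : Plane, f x + ⟪p, y - x⟫ ≤ f y}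

/-- `g` is the distributional divergence of the vector field `n` in the set `U`
(for `U` open): both are locally integrable in `U`, and
`∫_U n · ∇ψ = - ∫_U g ψ` for every `ψ ∈ C_c^∞(U)`. -/
def HasWeakDivOn (n : Plane → Plane) (g : Plane → ℝ) (U : Set Plane) : Prop :=
  LocallyIntegrableOn n U ∧ LocallyIntegrableOn g U ∧
    ∀ ψ : Plane → ℝ, ContDiff ℝ ∞ ψ → HasCompactSupport ψ → tsupport ψ ⊆ U →
      ∫ x in U, ⟪n x, gradient ψ x⟫ = -∫ x in U, g x * ψ x

/-- `g ∈ L^∞_loc(U)`: `g` is in `L^∞(K)` for every compact `K ⊆ U`. -/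
def MemLinftyLoc (g : Plane → ℝ) (U : Set Plane) : Prop :=
  ∀ K : Set Plane, IsCompact K → K ⊆ U → MemLp g ∞ (volume.restrict K)

/-- The open `φ`-tubular neighbourhood `{|d^E_φ| < R}` of `∂E`. -/
def tube (φ : Plane → ℝ) (E : Set Plane) (R : ℝ) : Set Plane :=
  {x | |phiSignedDist φ E x| < R}

/-- `n` is a Cahn-Hoffman field for `E` in `U`: it belongs to `L^∞(U; ℝ²)`, and at almost every
point of `U` the signed `φ`-distance is differentiable and `n ∈ ∂φ°(∇ d^E_φ)`. -/
def IsCahnHoffmanFieldOn (φ : Plane → ℝ) (E : Set Plane) (U : Set Plane) (n : Plane → Plane) :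
    Prop :=
  MemLp n ∞ (volume.restrict U) ∧
    ∀ᵐ x ∂(volume.restrict U), DifferentiableAt ℝ (phiSignedDist φ E) x ∧
      n x ∈ subdiff (polarAnisotropy φ) (gradient (phiSignedDist φ E) x)

end

/-! Write `d` for the signed distance. The geometric core is `exists_center_of_lt`: every `x` with
`d x > -R` has a centre `z` with `d z ≤ -R` and `φ (x - z) ≤ R + d x`, so there `R + d` is exactly
the `φ`-distance to `{d ≤ -R}`. Outside `E` this follows from the inner condition at a nearest
point. Inside, the largest ball about `x` has to be moved inwards at unit speed. If some contact
point has a centre in its own direction, one moves straight to it. Otherwise the two directions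
differ but lie on a common edge of the Wulff shape (`exists_aligned_center`), and the two balls fill
a half-neighbourhood of the contact point (`exists_half_nhds`). The connected contact set then lies
on one line, and the ball can slide off it and grow (`exists_enlargement`).

The analytic part exploits that in the plane the field `(x - z) / φ (x - z)`, with `z` the nearest
centre, has distributional divergence at most `1 / φ (x - z)`. Fields built from finitely many
centres need not converge, but their pairing with `∇d` tends to `1`. This suffices to pass to the
limit in a one-sided inequality for the increments of the polar along `∇χ`
(`integral_polar_sub_ge`); the complement gives the opposite bound.

Together, with `c = 1 / (R - |d|)` and a positive weight `w` that makes an `L²` setting possible on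
an unbounded tube, a convex functional of a pair of `L²` functions is nonnegative on all pairs `(∇ψ
/ w, c ψ / w)`. Hahn–Banach and Riesz (`exists_calibration`) give a dual pair: its first component
yields the field, its second the divergence, bounded by `c`. -/

open Filter Topology Set
open scoped NNReal

/-! ### Anisotropies, their balls and the signed distance -/

namespace IsAnisotropy

variable {φ : Plane → ℝ} (hφ : IsAnisotropy φ)
include hφ

theorem map_zero : φ 0 = 0 := by
  have := hφ.homogeneous 0 le_rfl 0
  simpa using this

theorem add_le (x y : Plane) : φ (x + y) ≤ φ x + φ y := by
  have h := hφ.convex.2 (mem_univ x) (mem_univ y) (by norm_num : (0 : ℝ) ≤ 1 / 2)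
    (by norm_num : (0 : ℝ) ≤ 1 / 2) (by norm_num)
  have h2 := hφ.homogeneous 2 (by norm_num) ((1 / 2 : ℝ) • x + (1 / 2 : ℝ) • y)
  have h3 : (2 : ℝ) • ((1 / 2 : ℝ) • x + (1 / 2 : ℝ) • y) = x + y := by
    module
  rw [h3] at h2
  simp only [smul_eq_mul] at h
  linarith

theorem nonneg (x : Plane) : 0 ≤ φ x := by
  obtain ⟨c, hc, h⟩ := hφ.coercive
  exact le_trans (by positivity) (h x).1

theorem sub_comm (x y : Plane) : φ (x - y) = φ (y - x) := by
  rw [← hφ.even, neg_sub]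

theorem smul_eq {t : ℝ} (ht : 0 ≤ t) (x : Plane) : φ (t • x) = t * φ x := hφ.homogeneous t ht x

theorem triangle (x y z : Plane) : φ (x - z) ≤ φ (x - y) + φ (y - z) := by
  have := hφ.add_le (x - y) (y - z)
  simpa using this

theorem sub_le (x y : Plane) : φ x - φ y ≤ φ (x - y) := by
  have := hφ.add_le (x - y) y
  rw [sub_add_cancel] at this
  linarith

theorem pos {x : Plane} (hx : x ≠ 0) : 0 < φ x := by
  obtain ⟨c, hc, h⟩ := hφ.coercive
  exact lt_of_lt_of_le (mul_pos hc (norm_pos_iff.2 hx)) (h x).1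

theorem exists_norm_bounds : ∃ C : ℝ, 0 < C ∧ ∀ x : Plane, φ x ≤ C * ‖x‖ ∧ ‖x‖ ≤ C * φ x := by
  obtain ⟨c, hc, h⟩ := hφ.coercive
  refine ⟨c⁻¹, by positivity, fun x => ⟨(h x).2, ?_⟩⟩
  rw [inv_mul_eq_div, le_div_iff₀ hc, mul_comm]
  exact (h x).1

theorem continuous : Continuous φ := by
  obtain ⟨C, hC, h⟩ := hφ.exists_norm_bounds
  refine (LipschitzWith.of_dist_le_mul (K := ⟨C, hC.le⟩) fun x y => ?_).continuous
  rw [Real.dist_eq, dist_eq_norm, abs_le]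
  have h1 := hφ.sub_le x y
  have h2 := hφ.sub_le y x
  rw [hφ.sub_comm y x] at h2
  have h3 := (h (x - y)).1
  change -(C * ‖x - y‖) ≤ _ ∧ _ ≤ C * ‖x - y‖
  constructor <;> linarith

/-- A supporting functional of an anisotropy at a given point. -/
theorem exists_support (u : Plane) : ∃ ν : Plane, (∀ w, ⟪ν, w⟫ ≤ φ w) ∧ ⟪ν, u⟫ = φ u := by
  by_cases hu : u = 0
  · refine ⟨0, fun w => ?_, ?_⟩
    · simpa using hφ.nonneg w
    · simp [hu, hφ.map_zero]
  let f : Plane →ₗ.[ℝ] ℝ := LinearPMap.mkSpanSingleton u (φ u) hu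
  obtain ⟨g, hg1, hg2⟩ := exists_extension_of_le_sublinear f φ
    (fun c hc x => hφ.homogeneous c hc.le x) hφ.add_le (by
      rintro ⟨x, hx⟩
      obtain ⟨t, rfl⟩ := Submodule.mem_span_singleton.1 hx
      have : f ⟨t • u, hx⟩ = t • φ u := LinearPMap.mkSpanSingleton'_apply _ _ _ _ _
      rw [this]
      rcases le_total 0 t with ht | ht
      · rw [hφ.smul_eq ht]; rfl
      · have h1 := hφ.nonneg (t • u)
        have h2 := hφ.nonneg u
        simp only [smul_eq_mul]
        nlinarith)
  refine ⟨(InnerProductSpace.toDual ℝ Plane).symm (LinearMap.toContinuousLinearMap g), ?_, ?_⟩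
  · intro w
    rw [InnerProductSpace.toDual_symm_apply]
    exact hg2 w
  · rw [InnerProductSpace.toDual_symm_apply]
    have h1 := hg1 ⟨u, Submodule.mem_span_singleton_self u⟩
    have : f ⟨u, Submodule.mem_span_singleton_self u⟩ = φ u :=
      LinearPMap.mkSpanSingleton_apply ℝ ℝ hu (φ u)
    rw [← this]
    exact h1

theorem mem_wulffAt {x y : Plane} {r : ℝ} (hr : 0 < r) : y ∈ wulffAt φ x r ↔ φ (y - x) ≤ r := by
  constructor
  · rintro ⟨w, hw, rfl⟩
    simp only [add_sub_cancel_left]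
    rw [hφ.smul_eq hr.le]
    have : φ w ≤ 1 := hw
    nlinarith
  · intro h
    refine ⟨r⁻¹ • (y - x), ?_, ?_⟩
    · change φ _ ≤ 1
      rw [hφ.smul_eq (by positivity), inv_mul_le_iff₀ hr]
      linarith
    · simp [smul_smul, hr.ne']

theorem isCompact_ball (x : Plane) (r : ℝ) : IsCompact {y | φ (y - x) ≤ r} := by
  obtain ⟨C, hC, h⟩ := hφ.exists_norm_bounds
  refine Metric.isCompact_of_isClosed_isBounded
    (isClosed_le (hφ.continuous.comp (continuous_id.sub continuous_const)) continuous_const) ?_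
  refine (Metric.isBounded_closedBall (x := x) (r := C * r)).subset fun y hy => ?_
  rw [Metric.mem_closedBall, dist_eq_norm]
  exact (h _).2.trans (by gcongr; exact hy)

theorem isOpen_ball (x : Plane) (r : ℝ) : IsOpen {y | φ (y - x) < r} :=
  isOpen_lt (hφ.continuous.comp (continuous_id.sub continuous_const)) continuous_const

/-! ### The polar -/

theorem polar_bddAbove (ν : Plane) : BddAbove ((fun x : Plane => ⟪ν, x⟫) '' wulffShape φ) := by
  obtain ⟨C, hC, h⟩ := hφ.exists_norm_bounds
  refine ⟨‖ν‖ * C, ?_⟩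
  rintro _ ⟨x, hx, rfl⟩
  have h1 : φ x ≤ 1 := hx
  have h2 : ‖x‖ ≤ C := (h x).2.trans (by nlinarith)
  exact (real_inner_le_norm _ _).trans (by gcongr)

theorem inner_le_polar {ν x : Plane} (hx : φ x ≤ 1) : ⟪ν, x⟫ ≤ polarAnisotropy φ ν :=
  le_csSup (hφ.polar_bddAbove ν) ⟨x, hx, rfl⟩

theorem polar_le {ν : Plane} {M : ℝ} (h : ∀ x, φ x ≤ 1 → ⟪ν, x⟫ ≤ M) :
    polarAnisotropy φ ν ≤ M := by
  refine csSup_le ⟨_, 0, ?_, rfl⟩ ?_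
  · change φ 0 ≤ 1
    rw [hφ.map_zero]; norm_num
  · rintro _ ⟨x, hx, rfl⟩
    exact h x hx

theorem polar_add_le (μ ν : Plane) :
    polarAnisotropy φ (μ + ν) ≤ polarAnisotropy φ μ + polarAnisotropy φ ν := by
  refine hφ.polar_le fun x hx => ?_
  rw [inner_add_left]
  exact add_le_add (hφ.inner_le_polar hx) (hφ.inner_le_polar hx)

theorem polar_smul_le {t : ℝ} (ht : 0 ≤ t) (ν : Plane) :
    polarAnisotropy φ (t • ν) ≤ t * polarAnisotropy φ ν := by
  refine hφ.polar_le fun x hx => ?_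
  rw [real_inner_smul_left]
  exact mul_le_mul_of_nonneg_left (hφ.inner_le_polar hx) ht

theorem polar_neg (ν : Plane) : polarAnisotropy φ (-ν) = polarAnisotropy φ ν := by
  have key : ∀ μ : Plane, polarAnisotropy φ (-μ) ≤ polarAnisotropy φ μ := fun μ => by
    refine hφ.polar_le fun x hx => ?_
    rw [inner_neg_left, ← inner_neg_right]
    exact hφ.inner_le_polar (by rwa [hφ.even])
  refine le_antisymm (key ν) ?_
  have := key (-ν)
  rwa [neg_neg] at this

theorem exists_polar_bound : ∃ C : ℝ, 0 < C ∧ (∀ ν, polarAnisotropy φ ν ≤ C * ‖ν‖) ∧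
    ∀ μ ν, |polarAnisotropy φ μ - polarAnisotropy φ ν| ≤ C * ‖μ - ν‖ := by
  obtain ⟨C, hC, h⟩ := hφ.exists_norm_bounds
  have key : ∀ ν, polarAnisotropy φ ν ≤ C * ‖ν‖ := fun ν => by
    refine hφ.polar_le fun x hx => ?_
    have h2 : ‖x‖ ≤ C := (h x).2.trans (by nlinarith)
    rw [mul_comm]
    exact (real_inner_le_norm _ _).trans (by gcongr)
  have key2 : ∀ μ ν, polarAnisotropy φ μ - polarAnisotropy φ ν ≤ C * ‖μ - ν‖ := fun μ ν => by
    have := hφ.polar_add_le (μ - ν) ν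
    rw [sub_add_cancel] at this
    linarith [key (μ - ν)]
  refine ⟨C, hC, key, fun μ ν => abs_sub_le_iff.2 ⟨key2 μ ν, ?_⟩⟩
  rw [norm_sub_rev]
  exact key2 ν μ

theorem polar_continuous : Continuous (polarAnisotropy φ) := by
  obtain ⟨C, hC, -, h⟩ := hφ.exists_polar_bound
  refine (LipschitzWith.of_dist_le_mul (K := ⟨C, hC.le⟩) fun x y => ?_).continuous
  rw [Real.dist_eq, dist_eq_norm]
  exact h x y

theorem polar_convex {a b : ℝ} (ha : 0 ≤ a) (hb : 0 ≤ b) (μ ν : Plane) :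
    polarAnisotropy φ (a • μ + b • ν) ≤ a * polarAnisotropy φ μ + b * polarAnisotropy φ ν :=
  (hφ.polar_add_le _ _).trans (add_le_add (hφ.polar_smul_le ha _) (hφ.polar_smul_le hb _))

/-! ### The distance to a set -/

theorem iInf_bddBelow (E : Set Plane) (x : Plane) :
    BddBelow (range fun y : E => φ (x - y)) :=
  ⟨0, by rintro _ ⟨y, rfl⟩; exact hφ.nonneg _⟩

theorem iInf_nonneg (E : Set Plane) (x : Plane) : 0 ≤ ⨅ y : E, φ (x - y) :=
  Real.iInf_nonneg fun _ => hφ.nonneg _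

theorem iInf_le_of_mem_closure {E : Set Plane} {x u : Plane} (hu : u ∈ closure E) :
    ⨅ y : E, φ (x - y) ≤ φ (x - u) := by
  have hcl : IsClosed {u : Plane | ⨅ y : E, φ (x - y) ≤ φ (x - u)} :=
    isClosed_le continuous_const (hφ.continuous.comp (continuous_const.sub continuous_id))
  refine hcl.closure_subset_iff.2 (fun y hy => ?_) hu
  exact ciInf_le (hφ.iInf_bddBelow E x) (⟨y, hy⟩ : E)

theorem iInf_le_add {E : Set Plane} (hE : E.Nonempty) (x y : Plane) :
    ⨅ u : E, φ (x - u) ≤ (⨅ u : E, φ (y - u)) + φ (x - y) := by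
  have : Nonempty E := hE.to_subtype
  rw [← sub_le_iff_le_add]
  refine le_ciInf fun u => ?_
  rw [sub_le_iff_le_add]
  refine (ciInf_le (hφ.iInf_bddBelow E x) u).trans ?_
  linarith [hφ.triangle x y u]

theorem exists_iInf_eq {E : Set Plane} (hE : E.Nonempty) (x : Plane) :
    ∃ u ∈ closure E, φ (x - u) = ⨅ y : E, φ (x - y) := by
  obtain ⟨e, he⟩ := hE
  have hc : IsCompact (closure E ∩ {y | φ (y - x) ≤ φ (e - x)}) :=
    (hφ.isCompact_ball x _).inter_left isClosed_closure
  obtain ⟨u, hu, hmin⟩ := hc.exists_isMinOn ⟨e, subset_closure he, le_refl (φ (e - x))⟩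
    (f := fun y => φ (x - y)) (hφ.continuous.comp (continuous_const.sub continuous_id)).continuousOn
  refine ⟨u, hu.1, le_antisymm ?_ (hφ.iInf_le_of_mem_closure hu.1)⟩
  have : Nonempty E := ⟨⟨e, he⟩⟩
  refine le_ciInf fun y => ?_
  by_cases hy : φ (y - x) ≤ φ (e - x)
  · exact hmin ⟨subset_closure y.2, hy⟩
  · push Not at hy
    have h1 : φ (u - x) ≤ φ (e - x) := hu.2
    rw [hφ.sub_comm x u, hφ.sub_comm x y]
    linarith

theorem iInf_eq_zero {E : Set Plane} {x : Plane} (hx : x ∈ closure E) :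
    ⨅ y : E, φ (x - y) = 0 := by
  refine le_antisymm ?_ (hφ.iInf_nonneg E x)
  have := hφ.iInf_le_of_mem_closure (x := x) hx
  rwa [sub_self, hφ.map_zero] at this

/-! ### The signed distance -/

theorem phiSignedDist_eq (E : Set Plane) (x : Plane) : phiSignedDist φ E x =
    (⨅ y : E, φ (x - y)) - ⨅ y : (Eᶜ : Set Plane), φ (x - y) := by
  unfold phiSignedDist
  simp_rw [fun y : (Eᶜ : Set Plane) => hφ.sub_comm (y : Plane) x]

theorem phiSignedDist_compl (E : Set Plane) (x : Plane) :
    phiSignedDist φ Eᶜ x = -phiSignedDist φ E x := by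
  rw [hφ.phiSignedDist_eq, hφ.phiSignedDist_eq, compl_compl, neg_sub]

theorem phiSignedDist_of_mem {E : Set Plane} {x : Plane} (hx : x ∈ E) :
    phiSignedDist φ E x = -⨅ y : (Eᶜ : Set Plane), φ (x - y) := by
  rw [hφ.phiSignedDist_eq, hφ.iInf_eq_zero (subset_closure hx), zero_sub]

theorem phiSignedDist_of_notMem {E : Set Plane} {x : Plane} (hx : x ∉ E) :
    phiSignedDist φ E x = ⨅ y : E, φ (x - y) := by
  rw [hφ.phiSignedDist_eq, hφ.iInf_eq_zero (E := Eᶜ) (subset_closure hx), sub_zero]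

theorem mem_of_phiSignedDist_neg {E : Set Plane} {x : Plane} (hx : phiSignedDist φ E x < 0) :
    x ∈ E := by
  by_contra h
  rw [hφ.phiSignedDist_of_notMem h] at hx
  exact absurd (hφ.iInf_nonneg E x) (not_le.2 hx)

/-- The signed distance is `1`-Lipschitz with respect to `φ`. -/
theorem phiSignedDist_le_add {E : Set Plane} (hE : E.Nonempty) (hE' : Eᶜ.Nonempty)
    (x y : Plane) : phiSignedDist φ E x ≤ phiSignedDist φ E y + φ (x - y) := by
  by_cases hx : x ∈ E <;> by_cases hy : y ∈ E
  · rw [hφ.phiSignedDist_of_mem hx, hφ.phiSignedDist_of_mem hy, hφ.sub_comm x y]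
    linarith [hφ.iInf_le_add hE' y x]
  · rw [hφ.phiSignedDist_of_mem hx, hφ.phiSignedDist_of_notMem hy]
    linarith [hφ.iInf_nonneg Eᶜ x, hφ.iInf_nonneg E y, hφ.nonneg (x - y)]
  -- Here two distances must be added: the segment from `x` to `y` meets the boundary, and `φ` is
  -- additive along it by homogeneity.
  · have hseg : ∃ u ∈ segment ℝ x y, u ∈ closure E ∧ u ∈ closure Eᶜ := by
      have hpre := (convex_segment (𝕜 := ℝ) x y).isPreconnected
      obtain ⟨u, hu, h⟩ := isPreconnected_closed_iff.1 hpre (closure E) (closure Eᶜ)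
        isClosed_closure isClosed_closure
        (fun u _ => (em (u ∈ E)).imp (fun h => subset_closure h) (fun h => subset_closure h))
        ⟨y, right_mem_segment ℝ x y, subset_closure hy⟩
        ⟨x, left_mem_segment ℝ x y, subset_closure hx⟩
      exact ⟨u, hu, h⟩
    obtain ⟨u, ⟨a, b, ha, hb, hab, rfl⟩, hu1, hu2⟩ := hseg
    have h1 := hφ.iInf_le_of_mem_closure (x := x) hu1
    have h2 := hφ.iInf_le_of_mem_closure (x := y) hu2
    have e1 : x - (a • x + b • y) = b • (x - y) := by
      have : a = 1 - b := by linarith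
      subst this; module
    have e2 : y - (a • x + b • y) = a • (y - x) := by
      have : b = 1 - a := by linarith
      subst this; module
    rw [e1, hφ.smul_eq hb] at h1
    rw [e2, hφ.smul_eq ha, hφ.sub_comm] at h2
    rw [hφ.phiSignedDist_of_notMem hx, hφ.phiSignedDist_of_mem hy]
    have : a * φ (x - y) + b * φ (x - y) = φ (x - y) := by rw [← add_mul, hab, one_mul]
    linarith
  · rw [hφ.phiSignedDist_of_notMem hx, hφ.phiSignedDist_of_notMem hy]
    linarith [hφ.iInf_le_add hE x y]

theorem phiSignedDist_empty (x : Plane) : phiSignedDist φ ∅ x = 0 := by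
  rw [hφ.phiSignedDist_eq, hφ.iInf_eq_zero (E := ∅ᶜ) (by simp)]
  simp [Real.iInf_of_isEmpty]

end IsAnisotropy

/-! ### Nondegeneracy, planar coordinates, nested connected sets -/

/-- An infimum over the empty set is `0` by convention, so for `E = ∅` the signed distance vanishes
identically and the plane `Eᶜ` has no centres to be covered from. The two-sided condition thus
excludes both trivial sets. -/
theorem InnerWulffCondition.nonempty_of_compl {φ : Plane → ℝ} (hφ : IsAnisotropy φ) {R : ℝ}
    (hR : 0 < R) {E : Set Plane} (h : InnerWulffCondition φ R Eᶜ) : E.Nonempty := by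
  by_contra hE
  rw [Set.not_nonempty_iff_eq_empty] at hE
  subst hE
  have h0 : (0 : Plane) ∈ closure (∅ᶜ : Set Plane) := by simp
  rw [h.1] at h0
  simp only [mem_iUnion, mem_ofPred_eq] at h0
  obtain ⟨x, hx, -⟩ := h0
  rw [hφ.phiSignedDist_compl, hφ.phiSignedDist_empty] at hx
  linarith

/-- Coordinates adapted to an edge of the Wulff shape with normal `ν`: `a` runs along the edge, `b`
is transverse to it. -/
theorem Plane.exists_coord {ν a b : Plane} (ha : a ≠ 0) (hνa : ⟪ν, a⟫ = 0) (hνb : ⟪ν, b⟫ ≠ 0) :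
    ∃ α : Plane →L[ℝ] ℝ, ∀ v : Plane, v = α v • a + (⟪ν, v⟫ / ⟪ν, b⟫) • b := by
  have hli : LinearIndependent ℝ ![a, b] := by
    rw [LinearIndependent.pair_iff]
    intro s t h
    have h1 : ⟪ν, s • a + t • b⟫ = 0 := by rw [h, inner_zero_right]
    rw [inner_add_right, real_inner_smul_right, real_inner_smul_right, hνa, mul_zero, zero_add] at h1
    have ht : t = 0 := (mul_eq_zero.1 h1).resolve_right hνb
    subst ht
    rw [zero_smul, add_zero] at h
    exact ⟨(smul_eq_zero.1 h).resolve_right ha, rfl⟩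
  let B := basisOfLinearIndependentOfCardEqFinrank hli (by simp)
  refine ⟨LinearMap.toContinuousLinearMap (B.coord 0), fun v => ?_⟩
  have h1 : v = B.coord 0 v • a + B.coord 1 v • b := by
    conv_lhs => rw [← B.sum_repr v]
    simp [B, Fin.sum_univ_two]
  have h2 : ⟪ν, v⟫ / ⟪ν, b⟫ = B.coord 1 v := by
    rw [div_eq_iff hνb]
    conv_lhs => rw [h1]
    rw [inner_add_right, real_inner_smul_right, real_inner_smul_right, hνa, mul_zero, zero_add]
  rw [h2]
  exact h1

/-- A preconnected decreasing intersection of compact preconnected sets. -/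
theorem isPreconnected_iInter_nat {X : Type*} [TopologicalSpace X] [T2Space X] {K : ℕ → Set X}
    (hanti : Antitone K) (hc : ∀ n, IsCompact (K n)) (hp : ∀ n, IsPreconnected (K n)) :
    IsPreconnected (⋂ n, K n) := by
  have hC : IsCompact (⋂ n, K n) := by
    refine (hc 0).of_isClosed_subset (isClosed_iInter fun n => (hc n).isClosed) (iInter_subset _ 0)
  rw [isPreconnected_iff_subset_of_disjoint_closed]
  intro u v hu hv huv hdisj
  have hd : Disjoint ((⋂ n, K n) ∩ u) ((⋂ n, K n) ∩ v) := by
    rw [Set.disjoint_iff_inter_eq_empty, ← hdisj]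
    ext w; simp only [mem_inter_iff]; tauto
  obtain ⟨U, V, hU, hV, huU, hvV, hUV⟩ :=
    SeparatedNhds.of_isCompact_isCompact (hC.inter_right hu) (hC.inter_right hv) hd
  have hsub : (⋂ n, K n) ⊆ U ∪ V := fun w hw =>
    (huv hw).imp (fun h => huU ⟨hw, h⟩) (fun h => hvV ⟨hw, h⟩)
  -- By compactness some `K n` already lies in `U ∪ V`, and being connected it lies on one side.
  obtain ⟨n, hn⟩ := exists_subset_nhds_of_isCompact (V := K)
    (fun i j => ⟨max i j, hanti (le_max_left _ _), hanti (le_max_right _ _)⟩) hc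
    (fun w hw => (hU.union hV).mem_nhds (hsub hw))
  have hCn : (⋂ n, K n) ⊆ K n := iInter_subset _ n
  rcases (hp n).subset_or_subset hU hV hUV hn with h | h
  · left
    intro w hw
    refine (huv hw).resolve_right fun hwv => ?_
    exact Set.disjoint_left.1 hUV (h (hCn hw)) (hvV ⟨hw, hwv⟩)
  · right
    intro w hw
    refine (huv hw).resolve_left fun hwu => ?_
    exact Set.disjoint_left.1 hUV (huU ⟨hw, hwu⟩) (h (hCn hw))

/-! ### Contact points and aligned centres -/

namespace IsAnisotropy

variable {φ : Plane → ℝ} (hφ : IsAnisotropy φ)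
include hφ

theorem lipschitz_of_le_add {d : Plane → ℝ} (hd : ∀ x y, d x ≤ d y + φ (x - y)) :
    ∃ K : ℝ≥0, LipschitzWith K d := by
  obtain ⟨C, hC, h⟩ := hφ.exists_norm_bounds
  refine ⟨⟨C, hC.le⟩, LipschitzWith.of_dist_le_mul fun x y => ?_⟩
  rw [Real.dist_eq, dist_eq_norm, abs_le]
  have h1 := hd x y
  have h2 := hd y x
  rw [hφ.sub_comm y x] at h2
  have h3 := (h (x - y)).1
  change -(C * ‖x - y‖) ≤ _ ∧ _ ≤ C * ‖x - y‖
  constructor <;> linarith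

theorem phiSignedDist_continuous {E : Set Plane} (hE : E.Nonempty) (hE' : Eᶜ.Nonempty) :
    Continuous (phiSignedDist φ E) :=
  let ⟨_, hK⟩ := hφ.lipschitz_of_le_add (hφ.phiSignedDist_le_add hE hE')
  hK.continuous

theorem exists_center {E : Set Plane} {R : ℝ} (hR : 0 < R) (h : InnerWulffCondition φ R E)
    {y : Plane} (hy : y ∈ closure E) : ∃ z, phiSignedDist φ E z ≤ -R ∧ φ (y - z) ≤ R := by
  rw [h.1] at hy
  simp only [mem_iUnion, mem_ofPred_eq] at hy
  obtain ⟨z, hz, hyz⟩ := hy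
  exact ⟨z, hz, (hφ.mem_wulffAt hR).1 hyz⟩

theorem mem_of_lt {E : Set Plane} {x u : Plane} {r : ℝ} (hx : phiSignedDist φ E x ≤ -r)
    (hu : φ (u - x) < r) : u ∈ E := by
  by_contra h
  have hr : 0 < r := (hφ.nonneg _).trans_lt hu
  have hxE := hφ.mem_of_phiSignedDist_neg (E := E) (x := x) (by linarith)
  rw [hφ.phiSignedDist_of_mem hxE] at hx
  have := hφ.iInf_le_of_mem_closure (E := Eᶜ) (x := x) (subset_closure h)
  rw [hφ.sub_comm] at this
  linarith

theorem mem_closure_of_le {E : Set Plane} {x u : Plane} {r : ℝ} (hr : 0 < r)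
    (hx : phiSignedDist φ E x ≤ -r) (hu : φ (u - x) ≤ r) : u ∈ closure E := by
  have ht : Tendsto (fun t : ℝ => x + t • (u - x)) (𝓝[<] 1) (𝓝 u) := by
    have : Tendsto (fun t : ℝ => x + t • (u - x)) (𝓝 1) (𝓝 (x + (1 : ℝ) • (u - x))) :=
      (Continuous.tendsto (by fun_prop) _)
    rw [one_smul, add_sub_cancel] at this
    exact this.mono_left nhdsWithin_le_nhds
  refine mem_closure_of_tendsto ht ?_
  filter_upwards [Ioo_mem_nhdsLT (show (0 : ℝ) < 1 by norm_num)] with t ht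
  refine hφ.mem_of_lt hx ?_
  rw [add_sub_cancel_left, hφ.smul_eq ht.1.le]
  have := ht.1
  have := ht.2
  nlinarith [hφ.nonneg (u - x)]

/-- The outer ball through `y` has an open interior contained in `Eᶜ`, and moving from `y` towards
its centre enters that interior at once. -/
theorem closure_notMem_nhds {E : Set Plane} {R : ℝ} (hR : 0 < R)
    (h : InnerWulffCondition φ R Eᶜ) {y : Plane} (hy : y ∈ closure Eᶜ) : closure E ∉ 𝓝 y := by
  obtain ⟨z, hz, hyz⟩ := hφ.exists_center hR h hy
  intro hn
  have ht : Tendsto (fun t : ℝ => y + t • (z - y)) (𝓝[>] 0) (𝓝 y) := by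
    have : Tendsto (fun t : ℝ => y + t • (z - y)) (𝓝 0) (𝓝 (y + (0 : ℝ) • (z - y))) :=
      (Continuous.tendsto (by fun_prop) _)
    rw [zero_smul, add_zero] at this
    exact this.mono_left nhdsWithin_le_nhds
  obtain ⟨t, ht1, ht2⟩ := ((ht.eventually_mem hn).and
    (Ioo_mem_nhdsGT (show (0 : ℝ) < 1 by norm_num))).exists
  have hlt : φ (y + t • (z - y) - z) < R := by
    have e : y + t • (z - y) - z = (1 - t) • (y - z) := by module
    rw [e, hφ.smul_eq (by linarith [ht2.2])]
    nlinarith [ht2.1, ht2.2, hφ.nonneg (y - z)]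
  obtain ⟨e, he1, he2⟩ := mem_closure_iff.1 ht1 _ (hφ.isOpen_ball z R) hlt
  exact hφ.mem_of_lt hz he1 he2

/-- The signed distance sees `E` rather than `closure E`; by `closure_notMem_nhds` an open ball
inside `closure E` already lies inside `E`. -/
theorem phiSignedDist_le_of_subset {E : Set Plane} {R : ℝ} (hR : 0 < R) (hE' : Eᶜ.Nonempty)
    (h : InnerWulffCondition φ R Eᶜ) {x : Plane} {r : ℝ} (hr : 0 < r)
    (hx : ∀ u, φ (u - x) ≤ r → u ∈ closure E) : phiSignedDist φ E x ≤ -r := by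
  have key : ∀ u, φ (u - x) < r → u ∈ E := by
    intro u hu
    by_contra hn
    refine hφ.closure_notMem_nhds hR h (subset_closure hn) ?_
    filter_upwards [(hφ.isOpen_ball x r).mem_nhds hu] with v hv
    exact hx v (le_of_lt hv)
  have hxE : x ∈ E := key x (by rwa [sub_self, hφ.map_zero])
  rw [hφ.phiSignedDist_of_mem hxE, neg_le_neg_iff]
  have : Nonempty (Eᶜ : Set Plane) := hE'.to_subtype
  refine le_ciInf fun y => ?_
  by_contra hn
  push Not at hn
  rw [hφ.sub_comm] at hn
  exact y.2 (key y hn)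

theorem two_le_of_add_le {p q : Plane} {r s : ℝ} (hs : 0 < s) (hsr : s ≤ r) (hp : φ p ≤ 1)
    (h : r + s ≤ φ (r • p + s • q)) : 2 ≤ φ (p + q) := by
  have e : r • p + s • q = s • (p + q) + (r - s) • p := by module
  have h1 := hφ.add_le (s • (p + q)) ((r - s) • p)
  rw [← e, hφ.smul_eq hs.le, hφ.smul_eq (by linarith)] at h1
  have : 2 * s ≤ φ (p + q) * s := by nlinarith
  exact le_of_mul_le_mul_right this hs

/-- The conclusion says that the directions `q` and `m` from `x` and from `z` to `y` lie on a common
edge of the Wulff shape. Using `y` alone, the outer direction `p` is aligned with `q` and with `m`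
separately, which is not enough when `p` is a vertex. So centres are taken at nearby points `y'`
displaced along `p - q`, where alignment involves a mixture of `p` and `q`, and then `t → 0`. -/
theorem exists_aligned_center {E : Set Plane} {R : ℝ} (hR : 0 < R) (hE : E.Nonempty)
    (hE' : Eᶜ.Nonempty) (hin : InnerWulffCondition φ R E) (hout : InnerWulffCondition φ R Eᶜ)
    {x y : Plane} {s : ℝ} (hs : 0 < s) (hsR : s < R) (hx : phiSignedDist φ E x = -s)
    (hy : y ∈ closure Eᶜ) (hyx : φ (y - x) ≤ s) :
    ∃ z, phiSignedDist φ E z ≤ -R ∧ φ (y - z) ≤ R ∧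
      2 ≤ φ (s⁻¹ • (y - x) + R⁻¹ • (y - z)) := by
  obtain ⟨z', hz', hyz'⟩ := hφ.exists_center hR hout hy
  have hz'2 : R ≤ phiSignedDist φ E z' := by
    rw [hφ.phiSignedDist_compl] at hz'; linarith
  set q := s⁻¹ • (y - x) with hq
  set p := R⁻¹ • (z' - y) with hp
  have hyq : y - x = s • q := by rw [hq, smul_smul, mul_inv_cancel₀ hs.ne', one_smul]
  have hzp : z' - y = R • p := by rw [hp, smul_smul, mul_inv_cancel₀ hR.ne', one_smul]
  have hφq : φ q ≤ 1 := by
    rw [hq, hφ.smul_eq (by positivity), inv_mul_le_iff₀ hs]; linarith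
  have hφp : φ p ≤ 1 := by
    rw [hp, hφ.smul_eq (by positivity), inv_mul_le_iff₀ hR, hφ.sub_comm]; linarith
  have main : ∀ t : ℝ, 0 < t → t < 1 → ∃ z, phiSignedDist φ E z ≤ -R ∧
      φ (y + (t * s) • (p - q) - z) ≤ R ∧
      2 ≤ φ (q + R⁻¹ • (y + (t * s) • (p - q) - z)) := by
    intro t ht0 ht1
    set y' := y + (t * s) • (p - q) with hy'
    have hts : t * s / R < 1 := by rw [div_lt_one hR]; nlinarith
    have hts0 : 0 < t * s / R := by positivity
    -- With this `a` the displacement `t s (p - q)` replaces `q` by a mixture with `p` when seen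
    -- from `x`, and `p` by a mixture with `q` when seen from `z'`. Hence `y'` stays in both balls.
    set a := t * s / R with ha
    have haR : R * a = t * s := by rw [ha]; field_simp
    have e1 : y' - x = s • ((1 - t) • q + t • p) := by
      have : y' - x = (y - x) + (t * s) • (p - q) := by rw [hy']; module
      rw [this, hyq]; module
    have e2 : z' - y' = R • ((1 - a) • p + a • q) := by
      have : z' - y' = (z' - y) - (t * s) • (p - q) := by rw [hy']; module
      rw [this, hzp, ← haR]; module
    have hcomb : ∀ b : ℝ, 0 ≤ b → b ≤ 1 → ∀ u v, φ u ≤ 1 → φ v ≤ 1 →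
        φ ((1 - b) • u + b • v) ≤ 1 := by
      intro b hb0 hb1 u v hu hv
      refine (hφ.add_le _ _).trans ?_
      rw [hφ.smul_eq hb0, hφ.smul_eq (by linarith)]
      nlinarith
    have h1 : φ (y' - x) ≤ s := by
      rw [e1, hφ.smul_eq hs.le]
      nlinarith [hcomb t ht0.le ht1.le q p hφq hφp]
    have hpa := hcomb a hts0.le hts.le p q hφp hφq
    have h2 : φ (y' - z') ≤ R := by
      rw [hφ.sub_comm, e2, hφ.smul_eq hR.le]
      nlinarith
    have hyE : y' ∈ closure E := hφ.mem_closure_of_le hs hx.le h1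
    obtain ⟨z, hz, hyz⟩ := hφ.exists_center hR hin hyE
    refine ⟨z, hz, hyz, ?_⟩
    set m := R⁻¹ • (y' - z) with hm
    have hym : y' - z = R • m := by rw [hm, smul_smul, mul_inv_cancel₀ hR.ne', one_smul]
    have hφm : φ m ≤ 1 := by
      rw [hm, hφ.smul_eq (by positivity), inv_mul_le_iff₀ hR]; linarith
    -- The signed distance rises by at least `2 R` from `z` to `z'`.
    have h3 : R + R ≤ φ (R • ((1 - a) • p + a • q) + R • m) := by
      rw [← e2, ← hym, sub_add_sub_cancel]
      linarith [hφ.phiSignedDist_le_add hE hE' z' z]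
    have h4 := hφ.two_le_of_add_le hR le_rfl hpa h3
    -- Since `φ (p + m) ≤ 2`, a value of at least `2` at the mixture forces `φ (q + m) ≥ 2`.
    have e3 : (1 - a) • p + a • q + m = (1 - a) • (p + m) + a • (q + m) := by module
    have h5 := hφ.add_le ((1 - a) • (p + m)) (a • (q + m))
    rw [← e3, hφ.smul_eq (by linarith), hφ.smul_eq hts0.le] at h5
    have h6 := hφ.add_le p m
    have h7 : (1 - a) * φ (p + m) ≤ (1 - a) * 2 :=
      mul_le_mul_of_nonneg_left (by linarith) (by linarith)
    have : 2 * a ≤ φ (q + m) * a := by nlinarith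
    exact le_of_mul_le_mul_right this hts0
  have htn : ∀ n : ℕ, 0 < 1 / ((n : ℝ) + 2) ∧ 1 / ((n : ℝ) + 2) < 1 := fun n =>
    ⟨by positivity, by rw [div_lt_one (by positivity)]; linarith [n.cast_nonneg (α := ℝ)]⟩
  choose z hz1 hz2 hz3 using fun n : ℕ => main _ (htn n).1 (htn n).2
  set t : ℕ → ℝ := fun n => 1 / ((n : ℝ) + 2) with htdef
  have htend : Tendsto t atTop (𝓝 0) := by
    have := (tendsto_add_atTop_iff_nat 2).2 (tendsto_one_div_atTop_nhds_zero_nat (𝕜 := ℝ))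
    simpa [htdef] using this
  have hbdd : ∀ n, z n ∈ {u | φ (u - y) ≤ R + s * φ (p - q)} := by
    intro n
    change φ (z n - y) ≤ _
    have e : z n - y = (t n * s) • (p - q) - (y + (t n * s) • (p - q) - z n) := by module
    have h1 := hφ.add_le ((t n * s) • (p - q)) (-(y + (t n * s) • (p - q) - z n))
    rw [← sub_eq_add_neg, ← e, hφ.even, hφ.smul_eq (mul_nonneg (htn n).1.le hs.le)] at h1
    have h2 : t n * s * φ (p - q) ≤ s * φ (p - q) :=
      mul_le_mul_of_nonneg_right (by nlinarith [(htn n).2]) (hφ.nonneg _)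
    linarith [hz2 n]
  -- The centres stay in a compact ball, so a limit centre exists, and all three conditions are
  -- closed.
  obtain ⟨z0, -, k, hk, hlim⟩ := (hφ.isCompact_ball y _).tendsto_subseq hbdd
  have hyl : Tendsto (fun n => y + (t (k n) * s) • (p - q) - z (k n)) atTop (𝓝 (y - z0)) := by
    have h1 : Tendsto (fun n => t (k n)) atTop (𝓝 0) := htend.comp hk.tendsto_atTop
    have h2 := ((h1.mul_const s).smul_const (p - q)).const_add y
    have h3 := h2.sub hlim
    simpa using h3
  refine ⟨z0, ?_, ?_, ?_⟩
  · exact le_of_tendsto (((hφ.phiSignedDist_continuous hE hE').tendsto z0).comp hlim)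
      (Eventually.of_forall fun n => hz1 _)
  · exact le_of_tendsto ((hφ.continuous.tendsto _).comp hyl) (Eventually.of_forall fun n => hz2 _)
  · refine ge_of_tendsto ((hφ.continuous.tendsto _).comp ((hyl.const_smul R⁻¹).const_add q))
      (Eventually.of_forall fun n => hz3 _)

/-- If `q` and `m` lie on a common edge of the Wulff shape, then two homothetic Wulff shapes
touching at these points cover a half-neighbourhood of the contact point. -/
theorem exists_half_nhds {q m : Plane} {s r : ℝ} (hs : 0 < s) (hr : 0 < r) (hq : φ q ≤ 1)
    (hm : φ m ≤ 1) (hqm : 2 ≤ φ (q + m)) (hne : m ≠ q) :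
    ∃ ν : Plane, (∀ w, ⟪ν, w⟫ ≤ φ w) ∧ ⟪ν, q⟫ = 1 ∧
      ∀ᶠ v in 𝓝 (0 : Plane), ⟪ν, v⟫ ≤ 0 → φ (s • q + v) ≤ s ∨ φ (r • m + v) ≤ r := by
  obtain ⟨ν, hν, hνs⟩ := hφ.exists_support (q + m)
  have h1 := hν q
  have h2 := hν m
  have h3 : ⟪ν, q⟫ + ⟪ν, m⟫ = φ (q + m) := by rw [← inner_add_right, hνs]
  have hνq : ⟪ν, q⟫ = 1 := by linarith
  have hνm : ⟪ν, m⟫ = 1 := by linarith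
  have hνqm : ⟪ν, q + m⟫ = 2 := by rw [inner_add_right, hνq, hνm]; norm_num
  refine ⟨ν, hν, hνq, ?_⟩
  obtain ⟨α, hα⟩ := Plane.exists_coord (ν := ν) (a := m - q) (b := q + m) (sub_ne_zero.2 hne)
    (by rw [inner_sub_right, hνq, hνm, sub_self]) (by rw [hνqm]; norm_num)
  rw [hνqm] at hα
  have hcont : Tendsto (fun v => |α v| + |⟪ν, v⟫ / 2|) (𝓝 0) (𝓝 0) := by
    have : Continuous (fun v : Plane => |α v| + |⟪ν, v⟫ / 2|) := by fun_prop
    simpa using this.tendsto 0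
  filter_upwards [hcont.eventually (gt_mem_nhds (lt_min hs hr))] with v hv hνv
  obtain ⟨hv1, hv2⟩ := lt_min_iff.1 hv
  set a := α v with ha
  set b := -(⟪ν, v⟫ / 2) with hb
  have hb0 : 0 ≤ b := by rw [hb]; linarith
  have hvab : v = a • (m - q) - b • (q + m) := by
    have := hα v
    rw [← ha] at this
    rw [hb, neg_smul, sub_neg_eq_add]; exact this
  have habs : |⟪ν, v⟫ / 2| = b := by rw [← abs_neg, ← hb, abs_of_nonneg hb0]
  rw [habs] at hv1 hv2
  -- Collecting coefficients of `u` and `w`, the norm is at most `ρ - 2 min b c`. The sign of the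
  -- coordinate along the edge decides which of the two balls contains the point.
  have key : ∀ {u w : Plane} {c ρ : ℝ}, φ u ≤ 1 → φ w ≤ 1 → 0 ≤ c → c + b < ρ →
      φ (ρ • u + (c • (w - u) - b • (u + w))) ≤ ρ := by
    intro u w c ρ hu hw hc hcb
    rcases le_total b c with hbc | hbc
    · have e : ρ • u + (c • (w - u) - b • (u + w)) = (ρ - c - b) • u + (c - b) • w := by module
      rw [e]
      refine (hφ.add_le _ _).trans ?_
      rw [hφ.smul_eq (by linarith), hφ.smul_eq (by linarith)]
      nlinarith
    · have e : ρ • u + (c • (w - u) - b • (u + w)) = (ρ - c - b) • u + (b - c) • (-w) := by module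
      rw [e]
      refine (hφ.add_le _ _).trans ?_
      rw [hφ.smul_eq (by linarith), hφ.smul_eq (by linarith), hφ.even]
      nlinarith
  rcases le_total 0 a with h0 | h0
  · left
    rw [abs_of_nonneg h0] at hv1
    rw [hvab]
    exact key hq hm h0 hv1
  · right
    rw [abs_of_nonpos h0] at hv2
    have := key hm hq (neg_nonneg.2 h0) hv2
    have e : v = (-a) • (q - m) - b • (m + q) := by rw [hvab]; module
    rwa [← e] at this

end IsAnisotropy

/-! ### Connected contact sets and existence of centres -/

/-- As `s ≠ 0`, the line through the two points misses the origin, so its normal is fixed by the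
level `s`. -/
theorem Plane.eq_of_inner_eq {ν μ a b : Plane} {s : ℝ} (hs : s ≠ 0) (hab : a ≠ b)
    (h1 : ⟪ν, a⟫ = s) (h2 : ⟪ν, b⟫ = s) (h3 : ⟪μ, a⟫ = s) (h4 : ⟪μ, b⟫ = s) : ν = μ := by
  obtain ⟨α, hα⟩ := Plane.exists_coord (ν := ν) (a := a - b) (b := a) (sub_ne_zero.2 hab)
    (by rw [inner_sub_right, h1, h2, sub_self]) (by rwa [h1])
  refine ext_inner_right ℝ fun v => ?_
  have h5 : ⟪μ, a - b⟫ = 0 := by rw [inner_sub_right, h3, h4, sub_self]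
  conv_rhs => rw [hα v]
  rw [inner_add_right, real_inner_smul_right, real_inner_smul_right, h5, mul_zero, zero_add, h1, h3,
    div_mul_cancel₀ _ hs]

/-- A function on a preconnected set which takes the same value at nearby points is constant. -/
theorem IsPreconnected.eq_of_eventually_eq {X Y : Type*} [TopologicalSpace X] {C : Set X}
    (hC : IsPreconnected C) {f : X → Y} (h : ∀ y ∈ C, ∀ᶠ z in 𝓝 y, z ∈ C → f z = f y)
    {x y : X} (hx : x ∈ C) (hy : y ∈ C) : f x = f y := by
  have : PreconnectedSpace C := Subtype.preconnectedSpace hC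
  have hl : IsLocallyConstant (fun z : C => f z) := by
    rw [IsLocallyConstant.iff_eventually_eq]
    intro z
    filter_upwards [(continuous_subtype_val.tendsto z).eventually (h z z.2)] with w hw
    exact hw w.2
  exact hl.apply_eq_of_preconnectedSpace ⟨x, hx⟩ ⟨y, hy⟩

namespace IsAnisotropy

variable {φ : Plane → ℝ} (hφ : IsAnisotropy φ)
include hφ

/-- The hypothesis concerns `Eᶜ`, which need not be closed. Radii decreasing to `s` from strictly
above make each point of `closure Eᶜ` in the closed ball a limit of points of `Eᶜ` in the larger
ball, so the contact set is a decreasing intersection of compact connected closures. -/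
theorem isPreconnected_contact {E : Set Plane} {R : ℝ}
    (hconn : ∀ r, 0 < r → r < R → ∀ x, IsPreconnected (wulffAt φ x r ∩ Eᶜ))
    (x : Plane) {s : ℝ} (hs : 0 < s) (hsR : s < R) :
    IsPreconnected (closure Eᶜ ∩ {y | φ (y - x) ≤ s}) := by
  set r : ℕ → ℝ := fun n => s + (R - s) / (n + 2) with hr
  have hr1 : ∀ n, s < r n := fun n => by
    have : 0 < (R - s) / ((n : ℝ) + 2) := div_pos (by linarith) (by positivity)
    simp only [hr]; linarith
  have hr2 : ∀ n, r n < R := fun n => by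
    have : (R - s) / ((n : ℝ) + 2) < R - s := by
      rw [div_lt_iff₀ (by positivity)]
      nlinarith [n.cast_nonneg (α := ℝ)]
    simp only [hr]; linarith
  have hranti : Antitone r := fun m n hmn => by
    have : (m : ℝ) ≤ n := by exact_mod_cast hmn
    have : (R - s) / ((n : ℝ) + 2) ≤ (R - s) / ((m : ℝ) + 2) :=
      div_le_div_of_nonneg_left (by linarith) (by positivity) (by linarith)
    simp only [hr]; linarith
  have hrlim : Tendsto r atTop (𝓝 s) := by
    have := (tendsto_add_atTop_iff_nat 2).2 (tendsto_const_div_atTop_nhds_zero_nat (R - s))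
    simpa [hr] using this.const_add s
  have hW : ∀ n, wulffAt φ x (r n) = {y | φ (y - x) ≤ r n} := fun n => by
    ext y; exact hφ.mem_wulffAt (hs.trans (hr1 n))
  have heq : closure Eᶜ ∩ {y | φ (y - x) ≤ s} =
      ⋂ n, closure (wulffAt φ x (r n) ∩ Eᶜ) := by
    ext y
    simp only [mem_inter_iff, mem_iInter]
    constructor
    · rintro ⟨h1, h2⟩ n
      rw [mem_closure_iff]
      intro o ho hyo
      have hlt : φ (y - x) < r n := lt_of_le_of_lt h2 (hr1 n)
      obtain ⟨e, he1, he2⟩ := mem_closure_iff.1 h1 _ (ho.inter (hφ.isOpen_ball x (r n))) ⟨hyo, hlt⟩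
      refine ⟨e, he1.1, ?_, he2⟩
      rw [hW]
      exact le_of_lt (show φ (e - x) < r n from he1.2)
    · intro h
      refine ⟨closure_mono inter_subset_right (h 0), ?_⟩
      refine ge_of_tendsto hrlim (Eventually.of_forall fun n => ?_)
      have h1 : y ∈ closure (wulffAt φ x (r n)) := closure_mono inter_subset_left (h n)
      rw [hW, (hφ.isCompact_ball x (r n)).isClosed.closure_eq] at h1
      exact h1
  rw [heq]
  refine isPreconnected_iInter_nat ?_ ?_ ?_
  · intro m n hmn
    refine closure_mono (inter_subset_inter_left _ ?_)
    rw [hW, hW]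
    exact fun y (hy : φ (y - x) ≤ r n) => hy.trans (hranti hmn)
  · intro n
    refine ((hφ.isCompact_ball x (r n)).of_isClosed_subset isClosed_closure ?_)
    refine closure_minimal ?_ (hφ.isCompact_ball x (r n)).isClosed
    rw [hW]
    exact inter_subset_left
  · exact fun n => (hconn _ (hs.trans (hr1 n)) (hr2 n) x).closure

/-- If every contact point has a half-neighbourhood in `closure E`, then the contact set lies on
a line, and the Wulff shape can be enlarged. -/
theorem exists_enlargement {E : Set Plane} {R : ℝ} (hR : 0 < R)
    (hout : InnerWulffCondition φ R Eᶜ) {x : Plane} {s : ℝ} (hs : 0 < s)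
    (hC : IsPreconnected (closure Eᶜ ∩ {y | φ (y - x) ≤ s}))
    (hne : (closure Eᶜ ∩ {y | φ (y - x) ≤ s}).Nonempty)
    (hhalf : ∀ y ∈ closure Eᶜ ∩ {y | φ (y - x) ≤ s}, ∃ ν : Plane, (∀ w, ⟪ν, w⟫ ≤ φ w) ∧
      ⟪ν, y - x⟫ = s ∧ ∀ᶠ y' in 𝓝 y, ⟪ν, y' - x⟫ ≤ s → y' ∈ closure E) :
    ∃ q : Plane, φ q = 1 ∧ ∀ᶠ ε in 𝓝[>] (0 : ℝ), ∀ u, φ (u - (x - ε • q)) ≤ s + ε →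
      u ∈ closure E := by
  set C := closure Eᶜ ∩ {y | φ (y - x) ≤ s} with hCdef
  choose! ν hν1 hν2 hν3 using hhalf
  -- A nearby contact point strictly below the supporting line would have a full neighbourhood in
  -- `closure E`.
  have hflat : ∀ y ∈ C, ∀ᶠ y' in 𝓝 y, y' ∈ C → ⟪ν y, y' - x⟫ = s := by
    intro y hy
    filter_upwards [(hν3 y hy).eventually_nhds] with y' hy' hy'C
    refine le_antisymm ((hν1 y hy _).trans hy'C.2) ?_
    by_contra hlt
    push Not at hlt
    refine hφ.closure_notMem_nhds hR hout hy'C.1 ?_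
    have ho : ∀ᶠ u in 𝓝 y', ⟪ν y, u - x⟫ < s :=
      (isOpen_lt (by fun_prop) continuous_const).mem_nhds hlt
    filter_upwards [hy', ho] with u hu1 hu2
    exact hu1 hu2.le
  -- Unless it is a single point, a connected contact set has no isolated point. Two close contact
  -- points determine their common line, so `ν` is locally constant, hence constant.
  have hconst : ∀ y ∈ C, ∀ y' ∈ C, ν y = ν y' := by
    by_cases hnt : C.Nontrivial
    · have hperf := hC.preperfect_of_nontrivial hnt
      intro y hy y' hy'
      refine hC.eq_of_eventually_eq (fun y hy => ?_) hy hy'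
      filter_upwards [(hflat y hy).eventually_nhds] with z hz hzC
      obtain ⟨w, ⟨hwz, hw1, hw2⟩, hwC⟩ :=
        (accPt_iff_frequently.1 (hperf z hzC)).and_eventually (hz.and (hflat z hzC)) |>.exists.imp
          fun w hw => (⟨⟨hw.1.1, hw.2.1, hw.2.2⟩, hw.1.2⟩ : (w ≠ z ∧ _ ∧ _) ∧ w ∈ C)
      exact Plane.eq_of_inner_eq (a := w - x) (b := z - x) hs.ne' (fun h => hwz (by simpa using h))
        (hw2 hwC) (hν2 z hzC) (hw1 hwC) (hz.self_of_nhds hzC)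
    · rw [Set.not_nontrivial_iff] at hnt
      intro y hy y' hy'
      rw [hnt hy hy']
  obtain ⟨y0, hy0⟩ := hne
  have hφq : φ (s⁻¹ • (y0 - x)) = 1 := by
    have h1 : φ (y0 - x) = s := le_antisymm hy0.2 ((hν2 y0 hy0).symm.le.trans (hν1 y0 hy0 _))
    rw [hφ.smul_eq (by positivity), h1, inv_mul_cancel₀ hs.ne']
  set q := s⁻¹ • (y0 - x) with hq
  have hνq : ⟪ν y0, q⟫ = 1 := by
    rw [hq, real_inner_smul_right, hν2 y0 hy0, inv_mul_cancel₀ hs.ne']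
  refine ⟨q, hφq, ?_⟩
  -- Moving the centre by `-ε q` while enlarging the radius by `ε` keeps the supporting line fixed.
  -- Points violating the inclusion as `ε → 0` accumulate at a contact point and lie on the side of
  -- the line that is locally in `closure E`.
  by_contra hcon
  obtain ⟨ε, hεlim, hε⟩ := exists_seq_forall_of_frequently (not_eventually.1 hcon)
  push Not at hε
  choose u hu1 hu2 using hε
  have hε0 : Tendsto ε atTop (𝓝 0) := hεlim.mono_right nhdsWithin_le_nhds
  have hεpos : ∀ᶠ n in atTop, 0 < ε n := hεlim.eventually self_mem_nhdsWithin
  have hdist : ∀ n, 0 < ε n → φ (u n - x) ≤ s + 2 * ε n := by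
    intro n hn
    have h1 := hφ.add_le (u n - (x - ε n • q)) (-(ε n • q))
    rw [hφ.even, hφ.smul_eq hn.le, hφq] at h1
    have e : u n - (x - ε n • q) + -(ε n • q) = u n - x := by abel
    rw [e] at h1
    linarith [hu1 n]
  have hsmall : ∀ᶠ n in atTop, u n ∈ {y | φ (y - x) ≤ s + 2} := by
    filter_upwards [hεpos, hε0.eventually (gt_mem_nhds (show (0 : ℝ) < 1 by norm_num))] with n h1 h2
    exact (hdist n h1).trans (by linarith)
  obtain ⟨u0, -, k, hk, hlim⟩ := (hφ.isCompact_ball x (s + 2)).tendsto_subseq' hsmall.frequently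
  have hε0' := hε0.comp hk.tendsto_atTop
  have hεpos' := hk.tendsto_atTop.eventually hεpos
  have hu0s : φ (u0 - x) ≤ s := by
    have h1 : Tendsto (fun n => φ (u (k n) - x)) atTop (𝓝 (φ (u0 - x))) :=
      (hφ.continuous.tendsto _).comp (hlim.sub_const x)
    have h2 : Tendsto (fun n => s + 2 * ε (k n)) atTop (𝓝 s) := by
      simpa using (hε0'.const_mul 2).const_add s
    refine le_of_tendsto_of_tendsto h1 h2 ?_
    filter_upwards [hεpos'] with n hn
    exact hdist _ hn
  have hu0C : u0 ∈ C := by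
    refine ⟨?_, hu0s⟩
    refine mem_closure_of_tendsto hlim (Eventually.of_forall fun n h => ?_)
    exact hu2 (k n) (subset_closure h)
  obtain ⟨n, hn1, hn2⟩ := ((hlim.eventually (hν3 u0 hu0C)).and hεpos').exists
  refine hu2 (k n) (hn1 ?_)
  rw [hconst u0 hu0C y0 hy0]
  have h1 := (hν1 y0 hy0 _).trans (hu1 (k n))
  have e : u (k n) - (x - ε (k n) • q) = (u (k n) - x) + ε (k n) • q := by abel
  rw [e, inner_add_right, real_inner_smul_right, hνq] at h1
  simp only [Function.comp_apply]
  linarith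

/-- If an aligned centre lies in exactly the direction of its contact point, `x` moves straight to
it. If none does, every contact point has a half-neighbourhood in `closure E`, and the ball slides
and grows by the same amount, which loses nothing in `d x' + φ (x - x') ≤ d x`. -/
theorem exists_step {E : Set Plane} {R : ℝ} (hR : 0 < R) (hE : E.Nonempty)
    (hE' : Eᶜ.Nonempty) (hin : InnerWulffCondition φ R E) (hout : InnerWulffCondition φ R Eᶜ)
    {x : Plane} (hx1 : -R < phiSignedDist φ E x) (hx2 : phiSignedDist φ E x < 0) :
    ∃ x', φ (x - x') ≤ R + phiSignedDist φ E x ∧ (phiSignedDist φ E x' ≤ -R ∨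
      (phiSignedDist φ E x' < phiSignedDist φ E x ∧
        phiSignedDist φ E x' + φ (x - x') ≤ phiSignedDist φ E x)) := by
  obtain ⟨s, hs⟩ : ∃ s, phiSignedDist φ E x = -s := ⟨_, (neg_neg _).symm⟩
  have hs0 : 0 < s := by linarith
  have hsR : s < R := by linarith
  set C := closure Eᶜ ∩ {y | φ (y - x) ≤ s} with hC
  have hsub : ∀ u, φ (u - x) ≤ s → u ∈ closure E := fun u hu =>
    hφ.mem_closure_of_le hs0 hs.le hu
  have hne : C.Nonempty := by
    obtain ⟨u, hu, hux⟩ := hφ.exists_iInf_eq hE' x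
    rw [hφ.phiSignedDist_of_mem (hφ.mem_of_phiSignedDist_neg hx2), ← hux] at hs
    refine ⟨u, hu, ?_⟩
    change φ (u - x) ≤ s
    rw [hφ.sub_comm]
    linarith
  choose! z hz1 hz2 hz3 using fun y (hy : y ∈ C) =>
    hφ.exists_aligned_center hR hE hE' hin hout hs0 hsR hs hy.1 hy.2
  have hq : ∀ y ∈ C, φ (s⁻¹ • (y - x)) ≤ 1 := fun y hy => by
    rw [hφ.smul_eq (by positivity), inv_mul_le_iff₀ hs0, mul_one]
    exact hy.2
  have hm : ∀ y ∈ C, φ (R⁻¹ • (y - z y)) ≤ 1 := fun y hy => by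
    rw [hφ.smul_eq (by positivity), inv_mul_le_iff₀ hR, mul_one]
    exact hz2 y hy
  by_cases hgood : ∃ y ∈ C, R⁻¹ • (y - z y) = s⁻¹ • (y - x)
  · obtain ⟨y, hy, hyz⟩ := hgood
    refine ⟨z y, ?_, Or.inl (hz1 y hy)⟩
    have e : x - z y = (R - s) • (s⁻¹ • (y - x)) := by
      have e1 : y - z y = R • (s⁻¹ • (y - x)) := by
        rw [← hyz, smul_smul, mul_inv_cancel₀ hR.ne', one_smul]
      have e2 : y - x = s • (s⁻¹ • (y - x)) := by
        rw [smul_smul, mul_inv_cancel₀ hs0.ne', one_smul]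
      rw [sub_smul, ← e1, ← e2]
      abel
    rw [e, hφ.smul_eq (by linarith), hs]
    nlinarith [hq y hy]
  · push Not at hgood
    obtain ⟨q, hq1, hev⟩ := hφ.exists_enlargement hR hout hs0
      (hφ.isPreconnected_contact hin.2 x hs0 hsR) hne (by
        intro y hy
        obtain ⟨ν, hν1, hν2, hν3⟩ := hφ.exists_half_nhds hs0 hR (hq y hy) (hm y hy) (hz3 y hy)
          (hgood y hy)
        refine ⟨ν, hν1, ?_, ?_⟩
        · rw [real_inner_smul_right, inv_mul_eq_div, div_eq_one_iff_eq hs0.ne'] at hν2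
          exact hν2
        · have ht : Tendsto (fun y' => y' - y) (𝓝 y) (𝓝 0) := by
            have : Continuous fun y' : Plane => y' - y := by fun_prop
            simpa using this.tendsto y
          filter_upwards [ht.eventually hν3] with y' hy' hy's
          rw [real_inner_smul_right, inv_mul_eq_div, div_eq_one_iff_eq hs0.ne'] at hν2
          have e0 : y' - x = (y - x) + (y' - y) := by abel
          rw [smul_smul, smul_smul, mul_inv_cancel₀ hs0.ne', mul_inv_cancel₀ hR.ne', one_smul,
            one_smul, ← e0] at hy'
          rw [e0, inner_add_right, hν2] at hy's
          rcases hy' (by linarith) with h | h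
          · exact hsub y' h
          · have e1 : y - z y + (y' - y) = y' - z y := by abel
            rw [e1] at h
            exact hφ.mem_closure_of_le hR (hz1 y hy) h)
    obtain ⟨ε, hε1, hε2⟩ := (hev.and (Ioo_mem_nhdsGT (show 0 < R - s by linarith))).exists
    have hd := hφ.phiSignedDist_le_of_subset hR hE' hout (by linarith [hε2.1]) hε1
    have hφε : φ (x - (x - ε • q)) = ε := by
      rw [sub_sub_cancel, hφ.smul_eq hε2.1.le, hq1, mul_one]
    refine ⟨x - ε • q, ?_, Or.inr ⟨?_, ?_⟩⟩
    · rw [hφε, hs]; linarith [hε2.2]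
    · rw [hs]; linarith [hε2.1]
    · rw [hφε, hs]; linarith

/-- In the tube, the signed distance is realised by the centres of the inner Wulff shapes. -/
theorem exists_center_of_lt {E : Set Plane} {R : ℝ} (hR : 0 < R) (hE : E.Nonempty)
    (hE' : Eᶜ.Nonempty) (hin : InnerWulffCondition φ R E) (hout : InnerWulffCondition φ R Eᶜ)
    {x : Plane} (hx : -R < phiSignedDist φ E x) :
    ∃ z, phiSignedDist φ E z ≤ -R ∧ φ (x - z) ≤ R + phiSignedDist φ E x := by
  by_cases hxE : x ∈ E
  swap
  · obtain ⟨u, hu, hux⟩ := hφ.exists_iInf_eq hE x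
    obtain ⟨z, hz, huz⟩ := hφ.exists_center hR hin hu
    refine ⟨z, hz, ?_⟩
    rw [hφ.phiSignedDist_of_notMem hxE, ← hux]
    linarith [hφ.triangle x u z]
  have hx0 : phiSignedDist φ E x ≤ 0 := by
    rw [hφ.phiSignedDist_of_mem hxE]
    linarith [hφ.iInf_nonneg Eᶜ x]
  rcases hx0.eq_or_lt with hx0 | hx0
  · obtain ⟨z, hz, hxz⟩ := hφ.exists_center hR hin (subset_closure hxE)
    exact ⟨z, hz, by rw [hx0, add_zero]; exact hxz⟩
  have hdc := hφ.phiSignedDist_continuous hE hE'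
  have hφc : Continuous fun x' => φ (x - x') := hφ.continuous.comp (continuous_const.sub continuous_id)
  -- Among the points reachable without loss, a lowest one exists by compactness; a further step
  -- either reaches level `-R` or contradicts minimality.
  set S := {x' | φ (x' - x) ≤ R + phiSignedDist φ E x} ∩
    {x' | phiSignedDist φ E x' + φ (x - x') ≤ phiSignedDist φ E x} with hS
  have hSc : IsCompact S :=
    (hφ.isCompact_ball x _).inter_right (isClosed_le (hdc.add hφc) continuous_const)
  have hxS : x ∈ S := by
    constructor
    · change φ (x - x) ≤ _
      rw [sub_self, hφ.map_zero]; linarith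
    · change _ + φ (x - x) ≤ _
      rw [sub_self, hφ.map_zero]; linarith
  obtain ⟨x', hx'S, hmin⟩ := hSc.exists_isMinOn ⟨x, hxS⟩ hdc.continuousOn
  have h1 : φ (x' - x) ≤ R + phiSignedDist φ E x := hx'S.1
  have h2 : phiSignedDist φ E x' + φ (x - x') ≤ phiSignedDist φ E x := hx'S.2
  rw [hφ.sub_comm] at h1
  rcases le_or_gt (phiSignedDist φ E x') (-R) with h3 | h3
  · exact ⟨x', h3, h1⟩
  obtain ⟨x'', h4, h5⟩ := hφ.exists_step hR hE hE' hin hout h3 (by linarith [hφ.nonneg (x - x')])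
  have h6 := hφ.triangle x x' x''
  have h7 : φ (x - x'') ≤ R + phiSignedDist φ E x := by linarith
  rcases h5 with h5 | ⟨h5, h8⟩
  · exact ⟨x'', h5, h7⟩
  · have : x'' ∈ S := by
      constructor
      · change φ (x'' - x) ≤ _
        rwa [hφ.sub_comm]
      · change _ + φ (x - x'') ≤ _
        linarith
    exact absurd (hmin this) (not_le.2 h5)

end IsAnisotropy

/-! ### Divergence bounds for radial and nearest-centre fields -/

theorem Plane.integral_dilation (f : Plane → ℝ) (z : Plane) {r : ℝ} (hr : 0 < r) :
    ∫ x, f (z + r • (x - z)) = (r ^ 2)⁻¹ * ∫ x, f x := by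
  rw [integral_sub_right_eq_self (μ := volume) (fun u => f (z + r • u)) z,
    Measure.integral_comp_smul volume (fun u => f (z + u)) r,
    integral_add_left_eq_self (μ := volume) f z]
  rw [finrank_euclideanSpace_fin, abs_of_pos (by positivity), smul_eq_mul]

theorem Plane.integrable_dilation {f : Plane → ℝ} (hf : Integrable f) (z : Plane) {r : ℝ}
    (hr : r ≠ 0) : Integrable (fun x => f (z + r • (x - z))) := by
  have h1 : Integrable (fun u : Plane => f (z + u)) := hf.comp_add_left z
  have h2 : Integrable (fun u : Plane => f (z + r • u)) := h1.comp_smul hr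
  exact h2.comp_sub_right z

theorem measurable_gradient (f : Plane → ℝ) : Measurable (gradient f) :=
  (InnerProductSpace.toDual ℝ Plane).symm.continuous.measurable.comp (measurable_fderiv ℝ f)

theorem LipschitzWith.norm_gradient_le {f : Plane → ℝ} {K : ℝ≥0} (hf : LipschitzWith K f)
    (x : Plane) : ‖gradient f x‖ ≤ K := by
  rw [gradient, LinearIsometryEquiv.norm_map]
  exact norm_fderiv_le_of_lipschitz ℝ hf

theorem gradient_eq_zero_of_notMem_tsupport {f : Plane → ℝ} {x : Plane} (hx : x ∉ tsupport f) :
    gradient f x = 0 := by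
  rw [gradient, fderiv_of_notMem_tsupport (𝕜 := ℝ) hx, _root_.map_zero]

theorem DifferentiableAt.tendsto_slope_gradient {f : Plane → ℝ} {x : Plane}
    (hf : DifferentiableAt ℝ f x) (v : Plane) :
    Tendsto (fun t : ℝ => t⁻¹ * (f (x + t • v) - f x)) (𝓝[>] 0) (𝓝 ⟪gradient f x, v⟫) := by
  have := (hf.hasFDerivAt.hasLineDerivAt v).tendsto_slope_zero_right
  rw [inner_gradient_left]
  simpa using this

namespace IsAnisotropy

variable {φ : Plane → ℝ} (hφ : IsAnisotropy φ)
include hφ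

/-- On a set which is star-shaped about `z`, the radial field `(x - z) / φ (x - z)` has
distributional divergence at most `1 / φ (x - z)`. -/
theorem integral_radial_field_ge {C : Set Plane} (hCm : MeasurableSet C) {z : Plane}
    (hstar : ∀ x ∈ C, ∀ t : ℝ, 0 < t → t < 1 → z + t • (x - z) ∈ C) {χ : Plane → ℝ} {K : ℝ≥0}
    (hχ : LipschitzWith K χ) (hχc : HasCompactSupport χ) (hχ0 : ∀ x, 0 ≤ χ x) {δ : ℝ} (hδ : 0 < δ)
    (hδχ : ∀ x, χ x ≠ 0 → δ ≤ φ (x - z)) :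
    -∫ x in C, χ x / φ (x - z) ≤ ∫ x in C, ⟪gradient χ x, x - z⟫ / φ (x - z) := by
  obtain ⟨B, hB, hφB⟩ := hφ.exists_norm_bounds
  have hφm : Measurable fun x => φ (x - z) :=
    (hφ.continuous.comp (continuous_id.sub continuous_const)).measurable
  have hχm : Measurable χ := hχ.continuous.measurable
  set g : Plane → ℝ := fun x => χ x / φ (x - z) with hg
  have hgint : Integrable g := by
    refine Integrable.mono' ((hχ.continuous.integrable_of_hasCompactSupport (μ := volume) hχc).const_mul δ⁻¹)
      (hχm.div hφm).aestronglyMeasurable (Eventually.of_forall fun x => ?_)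
    rw [Real.norm_of_nonneg (div_nonneg (hχ0 x) (hφ.nonneg _))]
    by_cases hx : χ x = 0
    · simp [hx]
    · rw [div_eq_inv_mul]
      exact mul_le_mul_of_nonneg_right (inv_anti₀ hδ (hδχ x hx)) (hχ0 x)
  set f : Plane → ℝ := C.indicator g with hf
  have hfint : Integrable f := hgint.indicator hCm
  have hf0 : ∀ x, 0 ≤ f x := fun x =>
    indicator_nonneg (fun y _ => div_nonneg (hχ0 y) (hφ.nonneg _)) x
  set f1 : ℝ → Plane → ℝ := fun s =>
    C.indicator fun x => χ (x + s • (z - x)) / φ (x - z) with hf1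
  -- The dilation maps `C` into itself and homogeneity of `φ` gives the factor `1 - s`; off `C` the
  -- left side vanishes and the right side is nonnegative.
  have hf1le : ∀ s, 0 < s → s < 1 → ∀ x, f1 s x ≤ (1 - s) * f (z + (1 - s) • (x - z)) := by
    intro s hs0 hs1 x
    by_cases hx : x ∈ C
    · have hx' := hstar x hx (1 - s) (by linarith) (by linarith)
      simp only [hf1, hf, indicator_of_mem hx, indicator_of_mem hx', hg]
      have e : x + s • (z - x) = z + (1 - s) • (x - z) := by module
      rw [e, add_sub_cancel_left, hφ.smul_eq (by linarith)]
      rw [← mul_div_assoc, mul_div_mul_left _ _ (by linarith : (1 - s) ≠ 0)]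
    · simp only [hf1, indicator_of_notMem hx]
      exact mul_nonneg (by linarith) (hf0 _)
  have hf1m : ∀ s, Measurable (f1 s) := fun s =>
    ((hχm.comp (by fun_prop)).div hφm).indicator hCm
  have hf1int : ∀ s, 0 < s → s < 1 → Integrable (f1 s) := fun s hs0 hs1 => by
    refine Integrable.mono' ((Plane.integrable_dilation hfint z (r := 1 - s)
      (by linarith)).const_mul (1 - s)) (hf1m s).aestronglyMeasurable
      (Eventually.of_forall fun x => ?_)
    rw [Real.norm_of_nonneg]
    · exact hf1le s hs0 hs1 x
    · exact indicator_nonneg (fun y _ => div_nonneg (hχ0 _) (hφ.nonneg _)) x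
  set D : ℝ → Plane → ℝ := fun s x => s⁻¹ * (f1 s x - f x) with hD
  -- The Jacobian gives `(1 - s)⁻²` and homogeneity `1 - s`. The product has slope `1` at `s = 0`:
  -- dimension minus one.
  have hDle : ∀ s, 0 < s → s < 1 → ∫ x, D s x ≤ (1 - s)⁻¹ * ∫ x, f x := by
    intro s hs0 hs1
    have h1 : ∫ x, f1 s x ≤ (1 - s)⁻¹ * ∫ x, f x := by
      refine (integral_mono (hf1int s hs0 hs1) ((Plane.integrable_dilation hfint z (r := 1 - s)
        (by linarith)).const_mul (1 - s)) (hf1le s hs0 hs1)).trans_eq ?_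
      rw [integral_const_mul, Plane.integral_dilation f z (by linarith : 0 < 1 - s), ← mul_assoc]
      have : 1 - s ≠ 0 := by linarith
      field_simp
    simp only [hD]
    rw [integral_const_mul, integral_sub (hf1int s hs0 hs1) hfint, inv_mul_le_iff₀ hs0]
    have e : s * ((1 - s)⁻¹ * ∫ x, f x) = (1 - s)⁻¹ * (∫ x, f x) - ∫ x, f x := by
      have : 1 - s ≠ 0 := by linarith
      field_simp
      ring
    rw [e]
    linarith
  obtain ⟨ρ, hρ⟩ := hχc.isBounded.subset_closedBall z
  have hχρ : ∀ x, ρ < ‖x - z‖ → χ x = 0 := by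
    intro x hx
    by_contra hne
    have := hρ (subset_tsupport χ hne)
    rw [Metric.mem_closedBall, dist_eq_norm] at this
    linarith
  -- The quotients are bounded by `K * B` because `‖x - z‖ ≤ B φ (x - z)`; for `s < 1/2` the
  -- dilation ratio exceeds `1/2`, so they vanish outside radius `2 |ρ|`.
  have hlim : Tendsto (fun s => ∫ x, D s x) (𝓝[>] 0)
      (𝓝 (∫ x, C.indicator (fun x => -(⟪gradient χ x, x - z⟫ / φ (x - z))) x)) := by
    refine tendsto_integral_filter_of_dominated_convergence
      ((Metric.closedBall z (2 * |ρ|)).indicator fun _ => (K : ℝ) * B) ?_ ?_ ?_ ?_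
    · exact Eventually.of_forall fun s =>
        (((hf1m s).sub ((hχm.div hφm).indicator hCm)).const_mul _).aestronglyMeasurable
    · filter_upwards [Ioo_mem_nhdsGT (show (0 : ℝ) < 1 / 2 by norm_num)] with s hs
      refine Eventually.of_forall fun x => ?_
      have hDx : D s x = C.indicator
          (fun x => s⁻¹ * ((χ (x + s • (z - x)) - χ x) / φ (x - z))) x := by
        by_cases hx : x ∈ C
        · simp only [hD, hf1, hf, hg, indicator_of_mem hx]; ring
        · simp only [hD, hf1, hf, indicator_of_notMem hx]; ring
      rw [hDx]
      by_cases hxρ : x ∈ Metric.closedBall z (2 * |ρ|)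
      · rw [indicator_of_mem hxρ]
        refine (norm_indicator_le_norm_self _ _).trans ?_
        have h1 := hχ.dist_le_mul (x + s • (z - x)) x
        rw [Real.dist_eq, dist_eq_norm, add_sub_cancel_left, norm_smul, Real.norm_of_nonneg hs.1.le,
          norm_sub_rev] at h1
        have h2 := (hφB (x - z)).2
        rw [norm_mul, norm_div, Real.norm_eq_abs (χ _ - χ x), Real.norm_of_nonneg (hφ.nonneg _),
          norm_inv, Real.norm_of_nonneg hs.1.le, inv_mul_le_iff₀ hs.1]
        refine div_le_of_le_mul₀ (hφ.nonneg _) (mul_nonneg hs.1.le (by positivity)) (h1.trans ?_)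
        have : (K : ℝ) * (s * ‖x - z‖) ≤ K * (s * (B * φ (x - z))) := by
          have := hs.1
          gcongr
        linarith
      · rw [indicator_of_notMem hxρ]
        rw [Metric.mem_closedBall, dist_eq_norm, not_le] at hxρ
        have hρ' := le_abs_self ρ
        have hρ0 := abs_nonneg ρ
        have h1 : χ x = 0 := hχρ x (by linarith)
        have h2 : χ (x + s • (z - x)) = 0 := by
          refine hχρ _ ?_
          have e : x + s • (z - x) - z = (1 - s) • (x - z) := by module
          rw [e, norm_smul, Real.norm_of_nonneg (by linarith [hs.2])]
          nlinarith [hs.2]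
        refine (norm_indicator_le_norm_self _ _).trans ?_
        rw [h1, h2]; simp
    · rw [integrable_indicator_iff Metric.isClosed_closedBall.measurableSet]
      exact integrableOn_const (measure_closedBall_lt_top.ne)
    · filter_upwards [hχ.ae_differentiableAt (μ := volume)] with x hx
      by_cases hxC : x ∈ C
      · have h1 := (hx.tendsto_slope_gradient (z - x)).div_const (φ (x - z))
        rw [indicator_of_mem hxC]
        have e : ⟪gradient χ x, z - x⟫ / φ (x - z) = -(⟪gradient χ x, x - z⟫ / φ (x - z)) := by
          rw [← neg_sub x z, inner_neg_right, neg_div]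
        rw [e] at h1
        refine h1.congr fun s => ?_
        simp only [hD, hf1, hf, hg, indicator_of_mem hxC]
        ring
      · simp only [hD, hf1, hf, indicator_of_notMem hxC, sub_zero, mul_zero]
        exact tendsto_const_nhds
  have hlim2 : Tendsto (fun s : ℝ => (1 - s)⁻¹ * ∫ x, f x) (𝓝[>] 0) (𝓝 (∫ x, f x)) := by
    have h1 : Tendsto (fun s : ℝ => 1 - s) (𝓝[>] 0) (𝓝 1) := by
      have : Tendsto (fun s : ℝ => 1 - s) (𝓝 0) (𝓝 (1 - 0)) :=
        Continuous.tendsto (by fun_prop) _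
      rw [sub_zero] at this
      exact this.mono_left nhdsWithin_le_nhds
    have := (h1.inv₀ one_ne_zero).mul_const (∫ x, f x)
    simpa using this
  have hfin := le_of_tendsto_of_tendsto hlim hlim2 (by
    filter_upwards [Ioo_mem_nhdsGT (show (0 : ℝ) < 1 by norm_num)] with s hs
    exact hDle s hs.1 hs.2)
  rw [integral_indicator hCm, integral_neg, hf, integral_indicator hCm] at hfin
  linarith

end IsAnisotropy

/-- The least index `i ≤ n` minimising `φ (x - z i)`. -/
noncomputable def nearestIndex (φ : Plane → ℝ) (z : ℕ → Plane) : ℕ → Plane → ℕ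
  | 0, _ => 0
  | n + 1, x => if φ (x - z (n + 1)) < φ (x - z (nearestIndex φ z n x)) then n + 1
      else nearestIndex φ z n x

theorem nearestIndex_spec (φ : Plane → ℝ) (z : ℕ → Plane) (n : ℕ) (x : Plane) :
    nearestIndex φ z n x ≤ n ∧
    (∀ j ≤ n, φ (x - z (nearestIndex φ z n x)) ≤ φ (x - z j)) ∧
    ∀ j < nearestIndex φ z n x, φ (x - z (nearestIndex φ z n x)) < φ (x - z j) := by
  induction n with
  | zero =>
    refine ⟨le_rfl, fun j hj => ?_, fun j hj => absurd hj (Nat.not_lt_zero j)⟩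
    rw [Nat.le_zero.1 hj]; rfl
  | succ n ih =>
    obtain ⟨h1, h2, h3⟩ := ih
    rw [nearestIndex]
    split_ifs with h
    · refine ⟨le_rfl, fun j hj => ?_, fun j hj => ?_⟩
      · rcases Nat.le_succ_iff.1 hj with hj | rfl
        · exact h.le.trans (h2 j hj)
        · exact le_rfl
      · exact h.trans_le (h2 j (Nat.lt_succ_iff.1 hj))
    · refine ⟨h1.trans n.le_succ, fun j hj => ?_, h3⟩
      rcases Nat.le_succ_iff.1 hj with hj | rfl
      · exact h2 j hj
      · exact not_lt.1 h

theorem nearestIndex_eq_of {φ : Plane → ℝ} {z : ℕ → Plane} {n i : ℕ} {x : Plane} (hi : i ≤ n)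
    (h1 : ∀ j ≤ n, φ (x - z i) ≤ φ (x - z j)) (h2 : ∀ j < i, φ (x - z i) < φ (x - z j)) :
    nearestIndex φ z n x = i := by
  obtain ⟨h3, h4, h5⟩ := nearestIndex_spec φ z n x
  rcases lt_trichotomy (nearestIndex φ z n x) i with h | h | h
  · exact absurd (h2 _ h) (not_lt.2 (h4 i hi))
  · exact h
  · exact absurd (h5 _ h) (not_lt.2 (h1 _ h3))

namespace IsAnisotropy

variable {φ : Plane → ℝ} (hφ : IsAnisotropy φ)
include hφ

theorem measurable_nearestIndex (z : ℕ → Plane) (n : ℕ) : Measurable (nearestIndex φ z n) := by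
  induction n with
  | zero => exact measurable_const
  | succ n ih =>
    refine Measurable.ite (measurableSet_lt ?_ ?_) measurable_const ih
    · exact hφ.continuous.measurable.comp (measurable_id.sub_const _)
    · exact hφ.continuous.measurable.comp (measurable_id.sub ((measurable_from_nat (f := z)).comp ih))

/-- On moving towards the nearest centre, no other distance decreases faster, by the triangle
inequality. Strict inequalities survive too, so the tie-break is unaffected and every cell is
star-shaped about its centre. -/
theorem nearestIndex_star (z : ℕ → Plane) (n : ℕ) {x : Plane} {t : ℝ} (ht0 : 0 < t) (ht1 : t < 1) :
    nearestIndex φ z n (z (nearestIndex φ z n x) + t • (x - z (nearestIndex φ z n x))) =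
      nearestIndex φ z n x := by
  obtain ⟨h1, h2, h3⟩ := nearestIndex_spec φ z n x
  set i := nearestIndex φ z n x
  have key : ∀ j, φ (x - z j) - (1 - t) * φ (x - z i) ≤ φ (z i + t • (x - z i) - z j) := by
    intro j
    have h := hφ.triangle x (z i + t • (x - z i)) (z j)
    have e : x - (z i + t • (x - z i)) = (1 - t) • (x - z i) := by module
    rw [e, hφ.smul_eq (by linarith)] at h
    linarith
  have e2 : φ (z i + t • (x - z i) - z i) = t * φ (x - z i) := by
    rw [add_sub_cancel_left, hφ.smul_eq ht0.le]
  refine nearestIndex_eq_of h1 (fun j hj => ?_) (fun j hj => ?_)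
  · rw [e2]; linarith [key j, h2 j hj]
  · rw [e2]; linarith [key j, h3 j hj]

/-- The field pointing away from the nearest of finitely many centres has distributional divergence
bounded above by the inverse of the distance. -/
theorem integral_nearest_field_ge (z : ℕ → Plane) (n : ℕ) {χ : Plane → ℝ} {K : ℝ≥0}
    (hχ : LipschitzWith K χ) (hχc : HasCompactSupport χ) (hχ0 : ∀ x, 0 ≤ χ x) {δ : ℝ} (hδ : 0 < δ)
    (hδχ : ∀ x, χ x ≠ 0 → ∀ i, δ ≤ φ (x - z i)) :
    Integrable (fun x => χ x / φ (x - z (nearestIndex φ z n x))) ∧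
    Integrable (fun x => ⟪gradient χ x, x - z (nearestIndex φ z n x)⟫ /
      φ (x - z (nearestIndex φ z n x))) ∧
    -∫ x, χ x / φ (x - z (nearestIndex φ z n x)) ≤
      ∫ x, ⟪gradient χ x, x - z (nearestIndex φ z n x)⟫ / φ (x - z (nearestIndex φ z n x)) := by
  obtain ⟨B, hB, hφB⟩ := hφ.exists_norm_bounds
  have him := hφ.measurable_nearestIndex z n
  have hzm : Measurable fun x => x - z (nearestIndex φ z n x) :=
    measurable_id.sub ((measurable_from_nat (f := z)).comp him)
  have hφm := hφ.continuous.measurable.comp hzm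
  have hint1 : Integrable (fun x => χ x / φ (x - z (nearestIndex φ z n x))) := by
    refine Integrable.mono' ((hχ.continuous.integrable_of_hasCompactSupport
      (μ := volume) hχc).const_mul δ⁻¹)
      (hχ.continuous.measurable.div hφm).aestronglyMeasurable (Eventually.of_forall fun x => ?_)
    rw [Real.norm_of_nonneg (div_nonneg (hχ0 x) (hφ.nonneg _))]
    by_cases hx : χ x = 0
    · simp [hx]
    · rw [div_eq_inv_mul]
      exact mul_le_mul_of_nonneg_right (inv_anti₀ hδ (hδχ x hx _)) (hχ0 x)
  have hint2 : Integrable (fun x => ⟪gradient χ x, x - z (nearestIndex φ z n x)⟫ /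
      φ (x - z (nearestIndex φ z n x))) := by
    refine Integrable.mono' (g := (tsupport χ).indicator fun _ => (K : ℝ) * B) ?_
      (((measurable_gradient χ).inner hzm).div hφm).aestronglyMeasurable
      (Eventually.of_forall fun x => ?_)
    · rw [integrable_indicator_iff (isClosed_tsupport χ).measurableSet]
      exact integrableOn_const hχc.measure_lt_top.ne
    · by_cases hx : x ∈ tsupport χ
      · rw [indicator_of_mem hx, norm_div, Real.norm_of_nonneg (hφ.nonneg _)]
        refine div_le_of_le_mul₀ (hφ.nonneg _) (by positivity) ?_
        refine (norm_inner_le_norm _ _).trans ?_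
        rw [mul_assoc]
        exact mul_le_mul (hχ.norm_gradient_le x) (hφB _).2 (norm_nonneg _) (by positivity)
      · rw [indicator_of_notMem hx, gradient_eq_zero_of_notMem_tsupport hx]
        simp
  refine ⟨hint1, hint2, ?_⟩
  set C : ℕ → Set Plane := fun i => {x | nearestIndex φ z n x = i} with hC
  have hCm : ∀ i, MeasurableSet (C i) := fun i => him (measurableSet_singleton i)
  have hCd : Set.Pairwise (↑(Finset.range (n + 1))) (Function.onFun Disjoint C) := by
    intro i _ j _ hij
    rw [Function.onFun, Set.disjoint_left]
    rintro x (rfl : _ = i) (h : _ = j)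
    exact hij h
  have hCu : (⋃ i ∈ Finset.range (n + 1), C i) = univ := by
    refine eq_univ_of_forall fun x => ?_
    simp only [mem_iUnion]
    exact ⟨nearestIndex φ z n x, Finset.mem_range.2 (Nat.lt_succ_iff.2 (nearestIndex_spec φ z n x).1),
      rfl⟩
  rw [← setIntegral_univ, ← setIntegral_univ (f := fun x => inner ℝ _ _ / _), ← hCu,
    integral_biUnion_finset _ (fun i _ => hCm i) hCd (fun i _ => hint1.integrableOn),
    integral_biUnion_finset _ (fun i _ => hCm i) hCd (fun i _ => hint2.integrableOn),
    ← Finset.sum_neg_distrib]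
  refine Finset.sum_le_sum fun i _ => ?_
  have e1 : ∫ x in C i, χ x / φ (x - z (nearestIndex φ z n x)) = ∫ x in C i, χ x / φ (x - z i) :=
    setIntegral_congr_fun (hCm i) fun x (hx : _ = i) => by simp only [hx]
  have e2 : ∫ x in C i, ⟪gradient χ x, x - z (nearestIndex φ z n x)⟫ /
      φ (x - z (nearestIndex φ z n x)) = ∫ x in C i, ⟪gradient χ x, x - z i⟫ / φ (x - z i) :=
    setIntegral_congr_fun (hCm i) fun x (hx : _ = i) => by simp only [hx]
  rw [e1, e2]
  refine hφ.integral_radial_field_ge (hCm i) ?_ hχ hχc hχ0 hδ (fun x hx => hδχ x hx i)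
  rintro x (rfl : _ = i) t ht0 ht1
  exact hφ.nearestIndex_star z n ht0 ht1

theorem polar_gradient_le_one {d : Plane → ℝ} (hd : ∀ x y, d x ≤ d y + φ (x - y)) {x : Plane}
    (hx : DifferentiableAt ℝ d x) : polarAnisotropy φ (gradient d x) ≤ 1 := by
  refine hφ.polar_le fun v hv => ?_
  refine (le_of_tendsto (hx.tendsto_slope_gradient v) ?_).trans hv
  filter_upwards [self_mem_nhdsWithin] with t ht
  have ht : 0 < t := ht
  have h := hd (x + t • v) x
  rw [add_sub_cancel_left, hφ.smul_eq ht.le] at h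
  rw [inv_mul_le_iff₀ ht]
  linarith

theorem map_normalized {v : Plane} (hv : v ≠ 0) : φ ((φ v)⁻¹ • v) = 1 := by
  have := hφ.pos hv
  rw [hφ.smul_eq (by positivity), inv_mul_cancel₀ this.ne']

/-- Along almost minimising centres, the radial field is asymptotically dual to the gradient. -/
theorem tendsto_inner_gradient {d : Plane → ℝ} (hd : ∀ x y, d x ≤ d y + φ (x - y)) {R : ℝ}
    {x : Plane} (hx : DifferentiableAt ℝ d x) (hxR : -R < d x) {z : ℕ → Plane}
    (hz : ∀ n, d (z n) ≤ -R) (hlim : Tendsto (fun n => φ (x - z n)) atTop (𝓝 (R + d x))) :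
    Tendsto (fun n => ⟪gradient d x, (φ (x - z n))⁻¹ • (x - z n)⟫) atTop (𝓝 1) := by
  obtain ⟨B, hB, hφB⟩ := hφ.exists_norm_bounds
  have hge : ∀ n, R + d x ≤ φ (x - z n) := fun n => by linarith [hd x (z n), hz n]
  have hne : ∀ n, x - z n ≠ 0 := fun n h => by
    have := hge n
    rw [h, hφ.map_zero] at this
    linarith
  set m : ℕ → Plane := fun n => (φ (x - z n))⁻¹ • (x - z n) with hm
  have hm1 : ∀ n, φ (m n) = 1 := fun n => hφ.map_normalized (hne n)
  have hmB : ∀ n, ‖m n‖ ≤ B := fun n => by simpa [hm1] using (hφB (m n)).2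
  have hle1 : ∀ n, ⟪gradient d x, m n⟫ ≤ 1 := fun n =>
    (hφ.inner_le_polar (hm1 n).le).trans (hφ.polar_gradient_le_one hd hx)
  rw [Metric.tendsto_atTop']
  intro η hη
  have hη' : 0 < η / (2 * B) := by positivity
  have hder := (hasFDerivAt_iff_isLittleO_nhds_zero.1 hx.hasFDerivAt).def hη'
  obtain ⟨ρ, hρ, hρd⟩ := Metric.eventually_nhds_iff.1 hder
  -- The step length is fixed by differentiability before `n` is chosen; `t ≤ R + d x` keeps the
  -- shifted point on the segment to `z n`.
  set t := min (ρ / (2 * B)) (R + d x) with ht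
  have ht0 : 0 < t := lt_min (by positivity) (by linarith)
  have htρ : t * B < ρ := by
    have : t * B ≤ ρ / (2 * B) * B := mul_le_mul_of_nonneg_right (min_le_left _ _) hB.le
    have e : ρ / (2 * B) * B = ρ / 2 := by field_simp
    linarith
  have hev := hlim.eventually (gt_mem_nhds (show R + d x < R + d x + t * (η / 2) by
    have : 0 < t * (η / 2) := by positivity
    linarith))
  obtain ⟨N, hN⟩ := eventually_atTop.1 hev
  refine ⟨N, fun n hn => ?_⟩
  have h1 : ‖(-t) • m n‖ ≤ t * B := by
    rw [norm_smul, norm_neg, Real.norm_of_nonneg ht0.le]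
    exact mul_le_mul_of_nonneg_left (hmB n) ht0.le
  have h2 := hρd (y := (-t) • m n) (by rw [dist_zero_right]; linarith)
  rw [← inner_gradient_left, real_inner_smul_right] at h2
  have h3 := (abs_le.1 h2).2
  have h3' := (abs_le.1 h2).1
  have h4 : η / (2 * B) * ‖(-t) • m n‖ ≤ t * (η / 2) := by
    have : η / (2 * B) * ‖(-t) • m n‖ ≤ η / (2 * B) * (t * B) := by gcongr
    have e : η / (2 * B) * (t * B) = t * (η / 2) := by field_simp
    linarith
  -- A step `t` towards `z n` lowers the upper bound on `d` by `t`, so the linear part of `d` must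
  -- fall by nearly `t`. The directions `m n` themselves need not converge.
  have h5 : d (x + (-t) • m n) ≤ φ (x - z n) - t - R := by
    have := hd (x + (-t) • m n) (z n)
    have hp := hφ.pos (hne n)
    have e : x + (-t) • m n - z n = (1 - t / φ (x - z n)) • (x - z n) := by
      simp only [hm]; module
    rw [e, hφ.smul_eq (by
      rw [sub_nonneg, div_le_one hp]; exact (min_le_right _ _).trans (hge n)), sub_mul, one_mul,
      div_mul_cancel₀ _ hp.ne'] at this
    linarith [hz n]
  have h6 := hN n hn.le
  have h7 : t * (1 - ⟪gradient d x, m n⟫) < t * η := by nlinarith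
  have h8 := lt_of_mul_lt_mul_left h7 ht0.le
  rw [Real.dist_eq, abs_lt]
  constructor <;> linarith [hle1 n]

end IsAnisotropy

/-! ### One-sided variational inequality -/

theorem LipschitzWith.integrable_gradient {χ : Plane → ℝ} {K : ℝ≥0}
    (hχ : LipschitzWith K χ) (hχc : HasCompactSupport χ) : Integrable (gradient χ) := by
  refine Integrable.mono' (g := (tsupport χ).indicator fun _ => (K : ℝ)) ?_
    (measurable_gradient χ).aestronglyMeasurable (Eventually.of_forall fun x => ?_)
  · rw [integrable_indicator_iff (isClosed_tsupport χ).measurableSet]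
    exact integrableOn_const hχc.measure_lt_top.ne
  · by_cases hx : x ∈ tsupport χ
    · rw [indicator_of_mem hx]; exact hχ.norm_gradient_le x
    · rw [indicator_of_notMem hx, gradient_eq_zero_of_notMem_tsupport hx, norm_zero]

namespace IsAnisotropy

variable {φ : Plane → ℝ} (hφ : IsAnisotropy φ)
include hφ

/-- The polar is Lipschitz, so the weight cancels and a multiple of `‖F‖` dominates. -/
theorem integrable_polar_sub {μ : Measure Plane} {w : Plane → ℝ} (hwm : Measurable w)
    (hw0 : ∀ x, 0 < w x) {G : Plane → Plane} (hG : Measurable G) {F : Plane → Plane}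
    (hF : Integrable F μ) : Integrable (fun x => w x *
      (polarAnisotropy φ (G x + (w x)⁻¹ • F x) - polarAnisotropy φ (G x))) μ := by
  obtain ⟨B, hB, -, hPB⟩ := hφ.exists_polar_bound
  refine Integrable.mono' (hF.norm.const_mul B) ?_ (Eventually.of_forall fun x => ?_)
  · have hwa : AEStronglyMeasurable w μ := hwm.aestronglyMeasurable
    have hGa : AEStronglyMeasurable G μ := hG.aestronglyMeasurable
    exact hwa.mul ((hφ.polar_continuous.comp_aestronglyMeasurable
      (hGa.add (hwm.inv.aestronglyMeasurable.smul hF.1))).sub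
      (hφ.polar_continuous.comp_aestronglyMeasurable hGa))
  · rw [norm_mul, Real.norm_of_nonneg (hw0 x).le, Real.norm_eq_abs]
    have h := hPB (G x + (w x)⁻¹ • F x) (G x)
    rw [add_sub_cancel_left, norm_smul, norm_inv, Real.norm_of_nonneg (hw0 x).le] at h
    have h2 := mul_le_mul_of_nonneg_left h (hw0 x).le
    have e : w x * (B * ((w x)⁻¹ * ‖F x‖)) = B * ‖F x‖ := by
      have := (hw0 x).ne'
      field_simp
    linarith

/-- One-sided variational inequality for a function which is realised from above by centres. -/
theorem integral_polar_sub_ge {d : Plane → ℝ} (hd : ∀ x y, d x ≤ d y + φ (x - y)) {R : ℝ}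
    (hA : ∀ x, -R < d x → ∃ z, d z ≤ -R ∧ φ (x - z) ≤ R + d x)
    {w : Plane → ℝ} (hwm : Measurable w) (hw0 : ∀ x, 0 < w x) (hw1 : ∀ x, w x ≤ 1)
    {χ : Plane → ℝ} {K : ℝ≥0} (hχ : LipschitzWith K χ) (hχc : HasCompactSupport χ)
    (hχ0 : ∀ x, 0 ≤ χ x) (hsupp : ∀ x ∈ tsupport χ, -R < d x) :
    -∫ x, χ x / (R + d x) ≤ ∫ x, w x * (polarAnisotropy φ (gradient d x + (w x)⁻¹ • gradient χ x)
      - polarAnisotropy φ (gradient d x)) := by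
  obtain ⟨Kd, hdL⟩ := hφ.lipschitz_of_le_add hd
  obtain ⟨B, hB, hφB⟩ := hφ.exists_norm_bounds
  rcases (tsupport χ).eq_empty_or_nonempty with hemp | ⟨x0, hx0⟩
  · have h1 : ∀ x, χ x = 0 := fun x => by
      by_contra h
      have := subset_tsupport χ h
      rw [hemp] at this
      exact this
    have h2 : ∀ x, gradient χ x = 0 := fun x =>
      gradient_eq_zero_of_notMem_tsupport (by rw [hemp]; exact notMem_empty x)
    simp [h1, h2]
  obtain ⟨z0, hz0, -⟩ := hA x0 (hsupp x0 hx0)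
  set A : Set Plane := {z | d z ≤ -R} with hAdef
  have : Nonempty A := ⟨⟨z0, hz0⟩⟩
  set z : ℕ → Plane := fun n => (TopologicalSpace.denseSeq A n : A) with hz
  have hzA : ∀ n, d (z n) ≤ -R := fun n => (TopologicalSpace.denseSeq A n : A).2
  have hge : ∀ x i, R + d x ≤ φ (x - z i) := fun x i => by linarith [hd x (z i), hzA i]
  obtain ⟨δ', hδ', hδ⟩ := hχc.isCompact.exists_forall_le' (f := d) hdL.continuous.continuousOn hsupp
  set N : ℕ → Plane → Plane := fun n x => z (nearestIndex φ z n x) with hN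
  set m : ℕ → Plane → Plane := fun n x => (φ (x - N n x))⁻¹ • (x - N n x) with hm
  have hNm : ∀ n, Measurable (N n) := fun n =>
    (measurable_from_nat (f := z)).comp (hφ.measurable_nearestIndex z n)
  have hmm : ∀ n, Measurable (m n) := fun n =>
    (hφ.continuous.measurable.comp (measurable_id.sub (hNm n))).inv.smul (measurable_id.sub (hNm n))
  have hlim : ∀ x, -R < d x → Tendsto (fun n => φ (x - N n x)) atTop (𝓝 (R + d x)) := by
    intro x hx
    obtain ⟨c, hc, hxc⟩ := hA x hx
    rw [Metric.tendsto_atTop]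
    intro ε hε
    have ho : IsOpen {y : A | φ (x - y) < R + d x + ε} :=
      isOpen_lt (hφ.continuous.comp (continuous_const.sub continuous_subtype_val)) continuous_const
    obtain ⟨_, hy, k, rfl⟩ := (TopologicalSpace.denseRange_denseSeq A).inter_open_nonempty _ ho
      ⟨⟨c, hc⟩, by change φ (x - c) < _; linarith⟩
    refine ⟨k, fun n hn => ?_⟩
    have h1 := (nearestIndex_spec φ z n x).2.1 k hn
    have h2 : φ (x - z k) < R + d x + ε := hy
    have h3 := hge x (nearestIndex φ z n x)
    rw [Real.dist_eq, abs_lt]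
    constructor <;> simp only [hN] <;> linarith
  have hdG := measurable_gradient d
  have hint := hφ.integrable_polar_sub (μ := volume) hwm hw0 hdG (hχ.integrable_gradient hχc)
  have hdae := hdL.ae_differentiableAt (μ := volume)
  set S := tsupport χ with hS
  have hSm : MeasurableSet S := (isClosed_tsupport χ).measurableSet
  -- The defect in the duality of `m n` with `∇d`; it vanishes in the limit by
  -- `tendsto_inner_gradient`.
  set err : ℕ → Plane → ℝ := fun n => S.indicator fun x => w x * (⟪gradient d x, m n x⟫ - 1) with herr
  have hmne : ∀ n, ∀ x ∈ S, φ (m n x) = 1 := fun n x hx => by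
    refine hφ.map_normalized fun h => ?_
    have := hge x (nearestIndex φ z n x)
    rw [show x - z (nearestIndex φ z n x) = 0 from h, hφ.map_zero] at this
    linarith [hsupp x hx]
  have herrm : ∀ n, Measurable (err n) := fun n =>
    (hwm.mul ((hdG.inner (hmm n)).sub_const 1)).indicator hSm
  have hboundi : Integrable (S.indicator fun _ => (Kd : ℝ) * B + 1) (volume : Measure Plane) := by
    rw [integrable_indicator_iff hSm]
    exact integrableOn_const hχc.measure_lt_top.ne
  have hbound : ∀ n x, ‖err n x‖ ≤ S.indicator (fun _ => (Kd : ℝ) * B + 1) x := by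
    intro n x
    by_cases hx : x ∈ S
    · simp only [herr, indicator_of_mem hx]
      rw [norm_mul, Real.norm_of_nonneg (hw0 x).le]
      have h1 : ‖⟪gradient d x, m n x⟫ - 1‖ ≤ (Kd : ℝ) * B + 1 := by
        refine (norm_sub_le _ _).trans ?_
        rw [norm_one]
        refine add_le_add ((norm_inner_le_norm _ _).trans ?_) le_rfl
        refine mul_le_mul (hdL.norm_gradient_le x) ?_ (norm_nonneg _) (by positivity)
        simpa [hmne n x hx] using (hφB (m n x)).2
      calc w x * ‖⟪gradient d x, m n x⟫ - 1‖ ≤ 1 * ((Kd : ℝ) * B + 1) :=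
            mul_le_mul (hw1 x) h1 (norm_nonneg _) zero_le_one
        _ = _ := one_mul _
    · simp [herr, indicator_of_notMem hx]
  have herrint : ∀ n, Integrable (err n) := fun n =>
    hboundi.mono' (herrm n).aestronglyMeasurable (Eventually.of_forall (hbound n))
  have herrlim : Tendsto (fun n => ∫ x, err n x) atTop (𝓝 0) := by
    have h := tendsto_integral_of_dominated_convergence (μ := (volume : Measure Plane))
      (f := fun _ => (0 : ℝ)) (S.indicator fun _ => (Kd : ℝ) * B + 1)
      (fun n => (herrm n).aestronglyMeasurable) hboundi
      (fun n => Eventually.of_forall (hbound n)) (by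
        filter_upwards [hdae] with x hx
        by_cases hxS : x ∈ S
        · have h1 := hφ.tendsto_inner_gradient hd hx (hsupp x hxS) (z := fun n => N n x)
            (fun n => hzA _) (hlim x (hsupp x hxS))
          have h2 := (h1.sub_const 1).const_mul (w x)
          simp only [sub_self, mul_zero] at h2
          simpa only [herr, indicator_of_mem hxS] using h2
        · simp only [herr, indicator_of_notMem hxS]
          exact tendsto_const_nhds)
    simpa using h
  have hfield : ∀ n, -(∫ x, χ x / (R + d x)) + ∫ x, err n x ≤ ∫ x, w x *
      (polarAnisotropy φ (gradient d x + (w x)⁻¹ • gradient χ x) -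
        polarAnisotropy φ (gradient d x)) := by
    intro n
    obtain ⟨hi1, hi2, hi3⟩ := hφ.integral_nearest_field_ge z n hχ hχc hχ0 (δ := R + δ')
      (by linarith) (fun x hx i => by
        linarith [hδ x (subset_tsupport χ hx), hge x i])
    have h1 : ∫ x, χ x / φ (x - z (nearestIndex φ z n x)) ≤ ∫ x, χ x / (R + d x) := by
      refine integral_mono hi1 ?_ fun x => ?_
      · refine Integrable.mono' ((hχ.continuous.integrable_of_hasCompactSupport
          (μ := volume) hχc).const_mul (R + δ')⁻¹)
          (hχ.continuous.measurable.div (hdL.continuous.measurable.const_add R)).aestronglyMeasurable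
          (Eventually.of_forall fun x => ?_)
        by_cases hx : χ x = 0
        · simp [hx]
        · have := hδ x (subset_tsupport χ hx)
          rw [Real.norm_of_nonneg (div_nonneg (hχ0 x) (by linarith)), div_eq_inv_mul]
          exact mul_le_mul_of_nonneg_right (inv_anti₀ (by linarith) (by linarith)) (hχ0 x)
      · by_cases hx : χ x = 0
        · simp [hx]
        · have := hδ x (subset_tsupport χ hx)
          exact div_le_div_of_nonneg_left (hχ0 x) (by linarith) (hge x _)
    have h2 : (∫ x, ⟪gradient χ x, x - z (nearestIndex φ z n x)⟫ /
        φ (x - z (nearestIndex φ z n x))) + ∫ x, err n x ≤ ∫ x, w x *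
      (polarAnisotropy φ (gradient d x + (w x)⁻¹ • gradient χ x) -
        polarAnisotropy φ (gradient d x)) := by
      rw [← integral_add hi2 (herrint n)]
      refine integral_mono_ae (hi2.add (herrint n)) hint ?_
      filter_upwards [hdae] with x hx
      by_cases hxS : x ∈ S
      · have h3 := hφ.inner_le_polar (ν := gradient d x + (w x)⁻¹ • gradient χ x)
          (hmne n x hxS).le
        have h4 := hφ.polar_gradient_le_one hd hx
        rw [inner_add_left, real_inner_smul_left] at h3
        have h5 : ⟪gradient χ x, x - z (nearestIndex φ z n x)⟫ /
            φ (x - z (nearestIndex φ z n x)) = ⟪gradient χ x, m n x⟫ := by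
          simp only [hm, hN]
          rw [real_inner_smul_right, div_eq_inv_mul]
        simp only [herr, indicator_of_mem hxS, h5]
        have hw := hw0 x
        have h6 := mul_le_mul_of_nonneg_left h3 hw.le
        rw [mul_add, mul_inv_cancel_left₀ hw.ne'] at h6
        nlinarith
      · simp [herr, indicator_of_notMem hxS, gradient_eq_zero_of_notMem_tsupport hxS]
    linarith
  have hfin := (tendsto_const_nhds (x := -∫ x, χ x / (R + d x))).add herrlim
  rw [add_zero] at hfin
  exact le_of_tendsto hfin (Eventually.of_forall hfield)

end IsAnisotropy

/-! ### Two-sided inequality for signed test functions -/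

theorem integrable_mul_of_tsupport_subset {χ c : Plane → ℝ} {V : Set Plane}
    (hχ : Continuous χ) (hχc : HasCompactSupport χ) (hV : tsupport χ ⊆ V) (hc : ContinuousOn c V) :
    Integrable (fun x => χ x * c x) := by
  rw [← integrableOn_iff_integrable_of_support_subset (s := tsupport χ)]
  · exact (hχ.continuousOn.mul (hc.mono hV)).integrableOn_compact hχc.isCompact
  · intro x hx
    refine subset_tsupport χ fun h => hx ?_
    simp [h]

theorem gradient_eq_zero_of_nonneg {χ : Plane → ℝ} (hχ : ∀ x, 0 ≤ χ x) {x : Plane} (hx : χ x = 0) :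
    gradient χ x = 0 := by
  have h : IsLocalMin χ x := Eventually.of_forall fun y => by rw [hx]; exact hχ y
  rw [gradient, h.fderiv_eq_zero, map_zero]

theorem gradient_neg (f : Plane → ℝ) (x : Plane) : gradient (fun y => -f y) x = -gradient f x := by
  rw [gradient, gradient, fderiv_fun_neg, map_neg]

theorem gradient_sub {f g : Plane → ℝ} {x : Plane} (hf : DifferentiableAt ℝ f x)
    (hg : DifferentiableAt ℝ g x) :
    gradient (fun y => f y - g y) x = gradient f x - gradient g x := by
  rw [gradient, fderiv_fun_sub hf hg, map_sub]; rfl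

theorem gradient_add {f g : Plane → ℝ} {x : Plane} (hf : DifferentiableAt ℝ f x)
    (hg : DifferentiableAt ℝ g x) : gradient (f + g) x = gradient f x + gradient g x := by
  rw [gradient, fderiv_add hf hg, map_add]; rfl

theorem gradient_const_smul {f : Plane → ℝ} {x : Plane} (hf : DifferentiableAt ℝ f x) (a : ℝ) :
    gradient (a • f) x = a • gradient f x := by
  rw [gradient, fderiv_const_smul hf, map_smul]; rfl

theorem tsupport_max_zero_subset (ψ : Plane → ℝ) : tsupport (fun x => max (ψ x) 0) ⊆ tsupport ψ :=
  closure_mono fun x hx h => hx (by simp [h])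

theorem LipschitzWith.max_zero {ψ : Plane → ℝ} {K : ℝ≥0} (h : LipschitzWith K ψ) :
    LipschitzWith K fun x => max (ψ x) 0 := h.max_const 0

namespace IsAnisotropy

variable {φ : Plane → ℝ} (hφ : IsAnisotropy φ)
include hφ

/-- The positive part of `ψ` is tested against `d` and the negative part against `-d`, which
evenness of the polar turns back into `d`. Almost everywhere at least one part has zero gradient, so
the increments of the polar add exactly. Both `1 / (R + d)` and `1 / (R - d)` are at most `1 / (R -
|d|)` in the tube. -/
theorem integral_polar_sub_add_nonneg {d : Plane → ℝ} (hd : ∀ x y, d x ≤ d y + φ (x - y)) {R : ℝ}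
    (hA : ∀ x, -R < d x → ∃ z, d z ≤ -R ∧ φ (x - z) ≤ R + d x)
    (hA' : ∀ x, d x < R → ∃ z, R ≤ d z ∧ φ (x - z) ≤ R - d x)
    {w : Plane → ℝ} (hwm : Measurable w) (hw0 : ∀ x, 0 < w x) (hw1 : ∀ x, w x ≤ 1)
    {ψ : Plane → ℝ} (hψ : ContDiff ℝ ∞ ψ) (hψc : HasCompactSupport ψ)
    (hsupp : tsupport ψ ⊆ {x | |d x| < R}) :
    0 ≤ (∫ x, w x * (polarAnisotropy φ (gradient d x + (w x)⁻¹ • gradient ψ x)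
      - polarAnisotropy φ (gradient d x))) + ∫ x, |ψ x| * (R - |d x|)⁻¹ := by
  obtain ⟨Kd, hdL⟩ := hφ.lipschitz_of_le_add hd
  obtain ⟨K, hK⟩ := ContDiff.lipschitzWith_of_hasCompactSupport hψc hψ (by simp)
  set χ1 : Plane → ℝ := fun x => max (ψ x) 0 with hχ1
  set χ2 : Plane → ℝ := fun x => max (-ψ x) 0 with hχ2
  have hψn : tsupport (fun x => -ψ x) = tsupport ψ := by
    simp [tsupport, Function.support]
  have hL1 : LipschitzWith K χ1 := hK.max_zero
  have hL2 : LipschitzWith K χ2 := LipschitzWith.max_zero (ψ := fun x => -ψ x) hK.neg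
  have hs1 : tsupport χ1 ⊆ tsupport ψ := tsupport_max_zero_subset ψ
  have hs2 : tsupport χ2 ⊆ tsupport ψ := hψn ▸ tsupport_max_zero_subset fun x => -ψ x
  have hc1 : HasCompactSupport χ1 := hψc.of_isClosed_subset (isClosed_tsupport _) hs1
  have hc2 : HasCompactSupport χ2 := hψc.of_isClosed_subset (isClosed_tsupport _) hs2
  have h01 : ∀ x, 0 ≤ χ1 x := fun x => le_max_right _ _
  have h02 : ∀ x, 0 ≤ χ2 x := fun x => le_max_right _ _
  have hmem : ∀ x ∈ tsupport ψ, -R < d x ∧ d x < R := fun x hx => abs_lt.1 (hsupp hx)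
  have hI1 := hφ.integral_polar_sub_ge hd hA hwm hw0 hw1 hL1 hc1 h01
    (fun x hx => (hmem x (hs1 hx)).1)
  have hI2 := hφ.integral_polar_sub_ge (d := fun x => -d x) (R := R)
    (fun x y => by linarith [hd y x, hφ.sub_comm x y]) (fun x hx => by
      obtain ⟨z, hz1, hz2⟩ := hA' x (by linarith)
      exact ⟨z, by linarith, by linarith⟩) hwm hw0 hw1 hL2 hc2 h02
    (fun x hx => by linarith [(hmem x (hs2 hx)).2])
  have hneg : ∀ x, w x * (polarAnisotropy φ (gradient (fun x => -d x) x + (w x)⁻¹ • gradient χ2 x)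
      - polarAnisotropy φ (gradient (fun x => -d x) x)) =
      w x * (polarAnisotropy φ (gradient d x + (w x)⁻¹ • (-gradient χ2 x))
      - polarAnisotropy φ (gradient d x)) := fun x => by
    rw [gradient_neg, hφ.polar_neg, ← hφ.polar_neg (-gradient d x + _)]
    congr 3
    module
  simp_rw [hneg] at hI2
  have hdG := measurable_gradient d
  have hi1 := hφ.integrable_polar_sub (μ := volume) hwm hw0 hdG (hL1.integrable_gradient hc1)
  have hi2 := hφ.integrable_polar_sub (μ := volume) hwm hw0 hdG (hL2.integrable_gradient hc2).neg
  simp only [Pi.neg_apply] at hi2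
  have hsplit : ∫ x, w x * (polarAnisotropy φ (gradient d x + (w x)⁻¹ • gradient ψ x)
      - polarAnisotropy φ (gradient d x)) =
      (∫ x, w x * (polarAnisotropy φ (gradient d x + (w x)⁻¹ • gradient χ1 x)
        - polarAnisotropy φ (gradient d x))) +
      ∫ x, w x * (polarAnisotropy φ (gradient d x + (w x)⁻¹ • (-gradient χ2 x))
        - polarAnisotropy φ (gradient d x)) := by
    rw [← integral_add hi1 hi2]
    refine integral_congr_ae ?_
    filter_upwards [hL1.ae_differentiableAt (μ := volume),
      hL2.ae_differentiableAt (μ := volume)] with x hx1 hx2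
    have e : ψ = fun y => χ1 y - χ2 y := by
      funext y
      simp only [hχ1, hχ2]
      rcases le_total 0 (ψ y) with h | h
      · rw [max_eq_left h, max_eq_right (by linarith)]; ring
      · rw [max_eq_right h, max_eq_left (by linarith)]; ring
    have eg : gradient ψ x = gradient χ1 x - gradient χ2 x := by
      conv_lhs => rw [e]
      exact gradient_sub hx1 hx2
    rcases le_total 0 (ψ x) with h | h
    · have : gradient χ2 x = 0 := gradient_eq_zero_of_nonneg h02 (by
        simp only [hχ2]; exact max_eq_right (by linarith))
      simp [eg, this]
    · have : gradient χ1 x = 0 := gradient_eq_zero_of_nonneg h01 (by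
        simp only [hχ1]; exact max_eq_right h)
      simp [eg, this]
  have hdc := hdL.continuous
  have hcont : ∀ {f : Plane → ℝ}, Continuous f → (∀ x, |d x| < R → f x ≠ 0) →
      ContinuousOn (fun x => (f x)⁻¹) {x | |d x| < R} := fun hf h => hf.continuousOn.inv₀ h
  have hj1 : Integrable fun x => χ1 x / (R + d x) := by
    simp_rw [div_eq_mul_inv]
    exact integrable_mul_of_tsupport_subset hL1.continuous hc1 (hs1.trans hsupp)
      (hcont (by fun_prop) fun x hx => by linarith [abs_lt.1 hx])
  have hj2 : Integrable fun x => χ2 x / (R + -d x) := by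
    simp_rw [div_eq_mul_inv]
    exact integrable_mul_of_tsupport_subset hL2.continuous hc2 (hs2.trans hsupp)
      (hcont (by fun_prop) fun x hx => by linarith [abs_lt.1 hx])
  have hj3 : Integrable fun x => |ψ x| * (R - |d x|)⁻¹ := by
    have hψa : tsupport (fun x => |ψ x|) = tsupport ψ := by simp [tsupport, Function.support]
    exact integrable_mul_of_tsupport_subset (χ := fun x => |ψ x|) hψ.continuous.abs
      (by rw [HasCompactSupport, hψa]; exact hψc) (by rw [hψa]; exact hsupp)
      (hcont (by fun_prop) fun x hx => by linarith)
  have hle : (∫ x, χ1 x / (R + d x)) + ∫ x, χ2 x / (R + -d x) ≤ ∫ x, |ψ x| * (R - |d x|)⁻¹ := by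
    rw [← integral_add hj1 hj2]
    refine integral_mono (hj1.add hj2) hj3 fun x => ?_
    change χ1 x / (R + d x) + χ2 x / (R + -d x) ≤ |ψ x| * (R - |d x|)⁻¹
    rcases lt_trichotomy (ψ x) 0 with h | h | h
    · have hx := hsupp (subset_tsupport ψ h.ne)
      have hx' : |d x| < R := hx
      simp only [hχ1, hχ2]
      rw [max_eq_right h.le, max_eq_left (by linarith), zero_div, zero_add, abs_of_neg h,
        div_eq_mul_inv]
      exact mul_le_mul_of_nonneg_left (inv_anti₀ (by linarith) (by linarith [le_abs_self (d x)]))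
        (by linarith)
    · simp [hχ1, hχ2, h]
    · have hx := hsupp (subset_tsupport ψ h.ne')
      have hx' : |d x| < R := hx
      simp only [hχ1, hχ2]
      rw [max_eq_left h.le, max_eq_right (by linarith), zero_div, add_zero, abs_of_pos h,
        div_eq_mul_inv]
      exact mul_le_mul_of_nonneg_left (inv_anti₀ (by linarith) (by linarith [neg_abs_le (d x)]))
        h.le
  linarith

end IsAnisotropy

/-! ### Duality: Hahn–Banach and Riesz representation -/

/-- A nonnegative convex continuous function on a subspace vanishing at the origin dominates a
continuous functional which vanishes on the subspace. -/
theorem exists_dual_le_of_convex {X : Type*} [NormedAddCommGroup X] [NormedSpace ℝ X]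
    {Φ : X → ℝ} (hconv : ConvexOn ℝ univ Φ) (hcont : Continuous Φ) (h0 : Φ 0 = 0)
    (V : Submodule ℝ X) (hV : ∀ ξ ∈ V, 0 ≤ Φ ξ) :
    ∃ L : X →L[ℝ] ℝ, (∀ ξ, L ξ ≤ Φ ξ) ∧ ∀ ξ ∈ V, L ξ = 0 := by
  set s : Set (X × ℝ) := {p | Φ p.1 < p.2} with hs
  have hsc : Convex ℝ s := by
    simpa [hs] using hconv.convex_strict_epigraph
  have hso : IsOpen s := isOpen_lt (hcont.comp continuous_fst) continuous_snd
  set t : Set (X × ℝ) := (V : Set X) ×ˢ {0} with ht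
  have htc : Convex ℝ t := V.convex.prod (convex_singleton 0)
  have hdisj : Disjoint s t := by
    rw [Set.disjoint_left]
    rintro ⟨ξ, r⟩ h1 ⟨h2, h3⟩
    have h1' : Φ ξ < r := h1
    have h3' : r = 0 := h3
    linarith [hV ξ h2]
  obtain ⟨f, u, hf1, hf2⟩ := geometric_hahn_banach_open hsc hso htc hdisj
  set L0 : X →L[ℝ] ℝ := f.comp (ContinuousLinearMap.inl ℝ X ℝ) with hL0
  set a := f (0, 1) with ha
  have hf : ∀ ξ r, f (ξ, r) = L0 ξ + r * a := fun ξ r => by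
    have e : ((ξ, r) : X × ℝ) = (ξ, 0) + r • (0, 1) := by simp
    rw [e, map_add, map_smul, smul_eq_mul]
    rfl
  have hu : u ≤ 0 := by
    have := hf2 (0, 0) ⟨V.zero_mem, rfl⟩
    rw [hf] at this
    simpa using this
  have hVL : ∀ ξ ∈ V, L0 ξ = 0 := by
    intro ξ hξ
    have key : ∀ c : ℝ, u ≤ c * L0 ξ := fun c => by
      have := hf2 (c • ξ, 0) ⟨V.smul_mem c hξ, rfl⟩
      rw [hf] at this
      simpa using this
    by_contra hne
    have := key ((u - 1) / L0 ξ)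
    rw [div_mul_cancel₀ _ hne] at this
    linarith
  -- The separating hyperplane is not vertical, so it can be normalised to the graph of a
  -- functional.
  have ha0 : a < 0 := by
    have := hf1 (0, 1) (by change Φ 0 < 1; rw [h0]; norm_num)
    rw [hf] at this
    simp at this
    linarith
  have hle : ∀ ξ, L0 ξ ≤ -a * Φ ξ := fun ξ => by
    refine le_of_forall_pos_le_add fun ε hε => ?_
    have hεa : 0 < ε / -a := by
      have : 0 < -a := by linarith
      positivity
    have := hf1 (ξ, Φ ξ + ε / -a) (by change Φ ξ < Φ ξ + ε / -a; linarith)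
    rw [hf] at this
    have e : (Φ ξ + ε / -a) * a = Φ ξ * a - ε := by
      rw [add_mul, div_neg, neg_mul, div_mul_cancel₀ _ ha0.ne]; ring
    rw [e] at this
    linarith
  refine ⟨(-a)⁻¹ • L0, fun ξ => ?_, fun ξ hξ => ?_⟩
  · change (-a)⁻¹ * L0 ξ ≤ _
    rw [inv_mul_le_iff₀ (by linarith)]
    exact hle ξ
  · change (-a)⁻¹ * L0 ξ = 0
    rw [hVL ξ hξ, mul_zero]

theorem MeasureTheory.MemLp.integrable_mul_norm_Lp {α E : Type*} [MeasurableSpace α]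
    {μ : Measure α} [NormedAddCommGroup E] {w : α → ℝ} (hw : MemLp w 2 μ) (F : Lp E 2 μ) :
    Integrable (fun x => w x * ‖F x‖) μ ∧ ∫ x, w x * ‖F x‖ ∂μ ≤ ‖hw.toLp w‖ * ‖F‖ := by
  have hF := (Lp.memLp F).norm
  have hae : (fun x => ⟪hw.toLp w x, hF.toLp _ x⟫) =ᵐ[μ] fun x => w x * ‖F x‖ := by
    filter_upwards [hw.coeFn_toLp, hF.coeFn_toLp] with x h1 h2
    rw [h1, h2, real_inner_eq_re_inner]
    simp [mul_comm]
  have hn : ‖hF.toLp (fun x => ‖F x‖)‖ = ‖F‖ := by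
    rw [Lp.norm_toLp, eLpNorm_norm, Lp.norm_def]
  refine ⟨(L2.integrable_inner (𝕜 := ℝ) (hw.toLp w) (hF.toLp _)).congr hae, ?_⟩
  rw [← integral_congr_ae hae, ← hn]
  exact real_inner_le_norm (hw.toLp w) (hF.toLp _)

namespace IsAnisotropy

variable {φ : Plane → ℝ} (hφ : IsAnisotropy φ)
include hφ

/-- Nonnegativity on `V` gives a continuous functional below the convex integral and zero on `V`;
Riesz represents it by `(n, g)`. Testing with indicator functions turns the integral bound into
pointwise ones. -/
theorem exists_calibration {μ : Measure Plane} [SigmaFinite μ] {D : Plane → Plane}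
    (hD : Measurable D) {w : Plane → ℝ} (hwm : Measurable w) (hw0 : ∀ x, 0 < w x)
    (hwi : Integrable w μ) (hw2 : MemLp w 2 μ) (V : Submodule ℝ (Lp Plane 2 μ × Lp ℝ 2 μ))
    (hV : ∀ ξ ∈ V, 0 ≤ (∫ x, w x * (polarAnisotropy φ (D x + ξ.1 x) - polarAnisotropy φ (D x)) ∂μ)
      + ∫ x, w x * ‖ξ.2 x‖ ∂μ) :
    ∃ (n : Lp Plane 2 μ) (g : Lp ℝ 2 μ),
      (∀ ξ ∈ V, (∫ x, ⟪n x, ξ.1 x⟫ ∂μ) + ∫ x, ⟪g x, ξ.2 x⟫ ∂μ = 0) ∧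
      (∀ᵐ x ∂μ, ∀ v, ⟪n x, v⟫ ≤ w x * (polarAnisotropy φ (D x + v) - polarAnisotropy φ (D x))) ∧
      ∀ᵐ x ∂μ, |g x| ≤ w x := by
  obtain ⟨B, hB, -, hPB⟩ := hφ.exists_polar_bound
  set P := polarAnisotropy φ with hP
  have hpint : ∀ F : Plane → Plane, Integrable (fun x => w x • F x) μ →
      Integrable (fun x => w x * (P (D x + F x) - P (D x))) μ := by
    intro F hF
    have := hφ.integrable_polar_sub hwm hw0 hD hF
    simpa only [inv_smul_smul₀ (hw0 _).ne'] using this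
  have hwF : ∀ F : Lp Plane 2 μ, Integrable (fun x => w x • F x) μ := fun F => by
    refine (integrable_norm_iff (hwm.aestronglyMeasurable.smul (Lp.aestronglyMeasurable F))).1 ?_
    refine (hw2.integrable_mul_norm_Lp F).1.congr (Eventually.of_forall fun x => ?_)
    change _ = ‖w x • F x‖
    rw [norm_smul, Real.norm_of_nonneg (hw0 x).le]
  have hi1 := fun F : Lp Plane 2 μ => hpint F (hwF F)
  have hi2 := fun f : Lp ℝ 2 μ => (hw2.integrable_mul_norm_Lp f).1
  set Φ : Lp Plane 2 μ × Lp ℝ 2 μ → ℝ := fun ξ =>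
    (∫ x, w x * (P (D x + ξ.1 x) - P (D x)) ∂μ) + ∫ x, w x * ‖ξ.2 x‖ ∂μ with hΦ
  have hΦ0 : Φ 0 = 0 := by
    have h1 : ∫ x, w x * (P (D x + (0 : Lp Plane 2 μ) x) - P (D x)) ∂μ = 0 :=
      integral_eq_zero_of_ae (by
        filter_upwards [Lp.coeFn_zero Plane 2 μ] with x hx
        rw [hx]; simp)
    have h2 : ∫ x, w x * ‖(0 : Lp ℝ 2 μ) x‖ ∂μ = 0 :=
      integral_eq_zero_of_ae (by
        filter_upwards [Lp.coeFn_zero ℝ 2 μ] with x hx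
        rw [hx]; simp)
    change (∫ x, w x * (P (D x + (0 : Lp Plane 2 μ) x) - P (D x)) ∂μ) +
      ∫ x, w x * ‖(0 : Lp ℝ 2 μ) x‖ ∂μ = 0
    rw [h1, h2, add_zero]
  have hconv : ConvexOn ℝ univ Φ := by
    refine ⟨convex_univ, fun ξ _ η _ a b ha hb hab => ?_⟩
    have h1 : ∫ x, w x * (P (D x + (a • ξ.1 + b • η.1 : Lp Plane 2 μ) x) - P (D x)) ∂μ ≤
        a * (∫ x, w x * (P (D x + ξ.1 x) - P (D x)) ∂μ) +
        b * (∫ x, w x * (P (D x + η.1 x) - P (D x)) ∂μ) := by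
      rw [← integral_const_mul, ← integral_const_mul,
        ← integral_add ((hi1 _).const_mul _) ((hi1 _).const_mul _)]
      refine integral_mono_ae (hi1 _) (((hi1 _).const_mul _).add ((hi1 _).const_mul _)) ?_
      filter_upwards [Lp.coeFn_add (a • ξ.1) (b • η.1), Lp.coeFn_smul a ξ.1,
        Lp.coeFn_smul b η.1] with x e1 e2 e3
      have h := hφ.polar_convex ha hb (D x + ξ.1 x) (D x + η.1 x)
      have e4 : a • (D x + ξ.1 x) + b • (D x + η.1 x) =
          D x + (a • ξ.1 + b • η.1 : Lp Plane 2 μ) x := by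
        rw [e1, Pi.add_apply, e2, e3, Pi.smul_apply, Pi.smul_apply]
        have : b = 1 - a := by linarith
        subst this
        module
      rw [e4] at h
      have h' := mul_le_mul_of_nonneg_left h (hw0 x).le
      have e5 : w x * P (D x) = a * (w x * P (D x)) + b * (w x * P (D x)) := by
        rw [← add_mul, hab, one_mul]
      change w x * (P _ - P (D x)) ≤ a * (w x * (P _ - P (D x))) + b * (w x * (P _ - P (D x)))
      linarith
    have h2 : ∫ x, w x * ‖(a • ξ.2 + b • η.2 : Lp ℝ 2 μ) x‖ ∂μ ≤
        a * (∫ x, w x * ‖ξ.2 x‖ ∂μ) + b * (∫ x, w x * ‖η.2 x‖ ∂μ) := by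
      rw [← integral_const_mul, ← integral_const_mul,
        ← integral_add ((hi2 _).const_mul _) ((hi2 _).const_mul _)]
      refine integral_mono_ae (hi2 _) (((hi2 _).const_mul _).add ((hi2 _).const_mul _)) ?_
      filter_upwards [Lp.coeFn_add (a • ξ.2) (b • η.2), Lp.coeFn_smul a ξ.2,
        Lp.coeFn_smul b η.2] with x e1 e2 e3
      rw [e1, Pi.add_apply, e2, e3, Pi.smul_apply, Pi.smul_apply]
      have h := norm_add_le (a • ξ.2 x) (b • η.2 x)
      rw [norm_smul, norm_smul, Real.norm_of_nonneg ha, Real.norm_of_nonneg hb] at h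
      have h' := mul_le_mul_of_nonneg_left h (hw0 x).le
      change w x * _ ≤ a * (w x * _) + b * (w x * _)
      linarith
    change (∫ x, w x * (P (D x + (a • ξ.1 + b • η.1 : Lp Plane 2 μ) x) - P (D x)) ∂μ) +
      ∫ x, w x * ‖(a • ξ.2 + b • η.2 : Lp ℝ 2 μ) x‖ ∂μ ≤ a * Φ ξ + b * Φ η
    simp only [hΦ]
    linarith
  have hcont : Continuous Φ := by
    have key : ∀ ξ η, Φ ξ - Φ η ≤ ((B + 1) * ‖hw2.toLp w‖) * ‖ξ - η‖ := by
      intro ξ η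
      have h1 : (∫ x, w x * (P (D x + ξ.1 x) - P (D x)) ∂μ) -
          (∫ x, w x * (P (D x + η.1 x) - P (D x)) ∂μ) ≤ B * ∫ x, w x * ‖(ξ.1 - η.1) x‖ ∂μ := by
        rw [← integral_sub (hi1 _) (hi1 _), ← integral_const_mul]
        refine integral_mono_ae ((hi1 _).sub (hi1 _))
          ((hw2.integrable_mul_norm_Lp (ξ.1 - η.1)).1.const_mul _) ?_
        filter_upwards [Lp.coeFn_sub ξ.1 η.1] with x e1
        have h := (le_abs_self _).trans (hPB (D x + ξ.1 x) (D x + η.1 x))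
        rw [add_sub_add_left_eq_sub] at h
        have h' := mul_le_mul_of_nonneg_left h (hw0 x).le
        rw [e1, Pi.sub_apply]
        change w x * (P _ - P (D x)) - w x * (P _ - P (D x)) ≤ B * (w x * _)
        linarith
      have h2 : (∫ x, w x * ‖ξ.2 x‖ ∂μ) - (∫ x, w x * ‖η.2 x‖ ∂μ) ≤
          ∫ x, w x * ‖(ξ.2 - η.2) x‖ ∂μ := by
        rw [← integral_sub (hi2 _) (hi2 _)]
        refine integral_mono_ae ((hi2 _).sub (hi2 _)) (hi2 _) ?_
        filter_upwards [Lp.coeFn_sub ξ.2 η.2] with x e1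
        have h' := mul_le_mul_of_nonneg_left (norm_sub_norm_le (ξ.2 x) (η.2 x)) (hw0 x).le
        rw [e1, Pi.sub_apply]
        change w x * _ - w x * _ ≤ w x * _
        linarith
      have h3 := (hw2.integrable_mul_norm_Lp (ξ.1 - η.1)).2
      have h4 := (hw2.integrable_mul_norm_Lp (ξ.2 - η.2)).2
      have h5 : ‖hw2.toLp w‖ * ‖ξ.1 - η.1‖ ≤ ‖hw2.toLp w‖ * ‖ξ - η‖ :=
        mul_le_mul_of_nonneg_left (norm_fst_le (ξ - η)) (norm_nonneg _)
      have h6 : ‖hw2.toLp w‖ * ‖ξ.2 - η.2‖ ≤ ‖hw2.toLp w‖ * ‖ξ - η‖ :=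
        mul_le_mul_of_nonneg_left (norm_snd_le (ξ - η)) (norm_nonneg _)
      have h7 := mul_le_mul_of_nonneg_left (h3.trans h5) hB.le
      simp only [hΦ]
      linarith
    refine (LipschitzWith.of_dist_le_mul (K := ⟨(B + 1) * ‖hw2.toLp w‖, by positivity⟩)
      fun ξ η => ?_).continuous
    rw [Real.dist_eq, dist_eq_norm]
    refine abs_sub_le_iff.2 ⟨key ξ η, ?_⟩
    rw [norm_sub_rev]
    exact key η ξ
  obtain ⟨L, hL1, hL2⟩ := exists_dual_le_of_convex hconv hcont hΦ0 V hV
  set n : Lp Plane 2 μ := (InnerProductSpace.toDual ℝ (Lp Plane 2 μ)).symm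
    (L.comp (ContinuousLinearMap.inl ℝ _ _)) with hn
  set g : Lp ℝ 2 μ := (InnerProductSpace.toDual ℝ (Lp ℝ 2 μ)).symm
    (L.comp (ContinuousLinearMap.inr ℝ _ _)) with hg
  have hnL : ∀ F : Lp Plane 2 μ, ⟪n, F⟫ = L (F, 0) := fun F => by
    rw [hn, InnerProductSpace.toDual_symm_apply]; rfl
  have hgL : ∀ f : Lp ℝ 2 μ, ⟪g, f⟫ = L (0, f) := fun f => by
    rw [hg, InnerProductSpace.toDual_symm_apply]; rfl
  refine ⟨n, g, fun ξ hξ => ?_, ?_, ?_⟩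
  · have h := hL2 ξ hξ
    have e : ξ = (ξ.1, 0) + (0, ξ.2) := by simp
    rw [e, map_add, ← hnL, ← hgL] at h
    exact h
  · have hv : ∀ v, ∀ᵐ x ∂μ, ⟪n x, v⟫ ≤ w x * (P (D x + v) - P (D x)) := by
      intro v
      have hwv : Integrable (fun x => w x * (P (D x + v) - P (D x))) μ :=
        hpint (fun _ => v) (hwi.smul_const v)
      have hnv : ∀ S, MeasurableSet S → μ S < ⊤ → IntegrableOn (fun x => ⟪n x, v⟫) S μ := by
        intro S hS hμS
        have := integrableOn_Lp_of_measure_ne_top n one_le_two hμS.ne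
        exact this.inner_const v
      have := ae_nonneg_of_forall_setIntegral_nonneg_of_sigmaFinite (μ := μ)
        (f := fun x => w x * (P (D x + v) - P (D x)) - ⟪n x, v⟫)
        (fun S hS hμS => hwv.integrableOn.sub (hnv S hS hμS)) (fun S hS hμS => by
          rw [integral_sub hwv.integrableOn (hnv S hS hμS), sub_nonneg]
          have h := hL1 (indicatorConstLp 2 hS hμS.ne v, 0)
          rw [← hnL, real_inner_comm, L2.inner_indicatorConstLp_eq_setIntegral_inner] at h
          have e1 : Φ (indicatorConstLp 2 hS hμS.ne v, 0) =
              ∫ x in S, w x * (P (D x + v) - P (D x)) ∂μ := by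
            have h2 : ∫ x, w x * ‖(0 : Lp ℝ 2 μ) x‖ ∂μ = 0 :=
              integral_eq_zero_of_ae (by
                filter_upwards [Lp.coeFn_zero ℝ 2 μ] with x hx
                rw [hx]; simp)
            simp only [hΦ]
            rw [h2, add_zero, ← integral_indicator hS]
            refine integral_congr_ae ?_
            filter_upwards [indicatorConstLp_coeFn (p := 2) (hs := hS) (hμs := hμS.ne) (c := v)]
              with x hx
            rw [hx]
            by_cases hxS : x ∈ S
            · simp [indicator_of_mem hxS]
            · simp [indicator_of_notMem hxS]
          rw [e1] at h
          simp_rw [real_inner_comm v]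
          exact h)
      filter_upwards [this] with x hx
      have hx : 0 ≤ w x * (P (D x + v) - P (D x)) - ⟪n x, v⟫ := hx
      linarith
    -- The null set depends on `v`; a countable dense set of `v` and continuity of the polar remove
    -- the dependence.
    have hall := ae_all_iff.2 fun k => hv (TopologicalSpace.denseSeq Plane k)
    filter_upwards [hall] with x hx
    have hcl : IsClosed {v | ⟪n x, v⟫ ≤ w x * (P (D x + v) - P (D x))} :=
      isClosed_le (by fun_prop) (continuous_const.mul
        ((hφ.polar_continuous.comp (continuous_const.add continuous_id)).sub continuous_const))
    intro v
    refine hcl.closure_subset_iff.2 ?_ (TopologicalSpace.denseRange_denseSeq Plane v)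
    rintro _ ⟨k, rfl⟩
    exact hx k
  · have hv : ∀ c : ℝ, |c| = 1 → ∀ᵐ x ∂μ, c * g x ≤ w x := by
      intro c hc
      have hgv : ∀ S, MeasurableSet S → μ S < ⊤ → IntegrableOn (fun x => c * g x) S μ := by
        intro S hS hμS
        have := (integrableOn_Lp_of_measure_ne_top g (by norm_num) hμS.ne).const_mul c
        exact this
      have := ae_nonneg_of_forall_setIntegral_nonneg_of_sigmaFinite (μ := μ)
        (f := fun x => w x - c * g x)
        (fun S hS hμS => hwi.integrableOn.sub (hgv S hS hμS)) (fun S hS hμS => by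
          rw [integral_sub hwi.integrableOn (hgv S hS hμS), sub_nonneg]
          have h := hL1 (0, indicatorConstLp 2 hS hμS.ne c)
          rw [← hgL, real_inner_comm, L2.inner_indicatorConstLp_eq_setIntegral_inner] at h
          have e1 : Φ (0, indicatorConstLp 2 hS hμS.ne c) = ∫ x in S, w x ∂μ := by
            have h2 : ∫ x, w x * (P (D x + (0 : Lp Plane 2 μ) x) - P (D x)) ∂μ = 0 :=
              integral_eq_zero_of_ae (by
                filter_upwards [Lp.coeFn_zero Plane 2 μ] with x hx
                rw [hx]; simp)
            simp only [hΦ]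
            rw [h2, zero_add, ← integral_indicator hS]
            refine integral_congr_ae ?_
            filter_upwards [indicatorConstLp_coeFn (p := 2) (hs := hS) (hμs := hμS.ne) (c := c)]
              with x hx
            rw [hx]
            by_cases hxS : x ∈ S
            · simp [indicator_of_mem hxS, hc]
            · simp [indicator_of_notMem hxS]
          rw [e1] at h
          refine le_of_eq_of_le ?_ h
          refine integral_congr_ae (Eventually.of_forall fun x => ?_)
          simp [mul_comm])
      filter_upwards [this] with x hx
      have hx : 0 ≤ w x - c * g x := hx
      linarith
    filter_upwards [hv 1 (by simp), hv (-1) (by simp)] with x h1 h2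
    rw [abs_le]
    constructor <;> linarith

end IsAnisotropy

/-! ### Weights, test pairs and the conclusion -/

/-- A positive integrable weight on the plane. -/
noncomputable def planeWeight (x : Plane) : ℝ := ((1 + ‖x‖ ^ 2) ^ 2)⁻¹

theorem planeWeight_pos (x : Plane) : 0 < planeWeight x := by unfold planeWeight; positivity

theorem planeWeight_le_one (x : Plane) : planeWeight x ≤ 1 :=
  inv_le_one_of_one_le₀ (one_le_pow₀ (by nlinarith [sq_nonneg ‖x‖]))

theorem continuous_planeWeight : Continuous planeWeight :=
  Continuous.inv₀ (by fun_prop) fun x => by positivity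

theorem integrable_planeWeight : Integrable planeWeight := by
  have h := integrable_rpow_neg_one_add_norm_sq (E := Plane) (μ := volume) (r := 4)
    (by rw [finrank_euclideanSpace_fin]; norm_num)
  refine h.congr (Eventually.of_forall fun x => ?_)
  have h1 : (0 : ℝ) ≤ 1 + ‖x‖ ^ 2 := by positivity
  change (1 + ‖x‖ ^ 2) ^ (-4 / 2 : ℝ) = ((1 + ‖x‖ ^ 2) ^ 2)⁻¹
  rw [show (-4 / 2 : ℝ) = -(2 : ℕ) by norm_num, Real.rpow_neg h1, Real.rpow_natCast]

theorem memLp_two_planeWeight : MemLp planeWeight 2 volume := by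
  rw [memLp_two_iff_integrable_sq continuous_planeWeight.aestronglyMeasurable]
  refine integrable_planeWeight.mono' (continuous_planeWeight.pow 2).aestronglyMeasurable
    (Eventually.of_forall fun x => ?_)
  have h0 := planeWeight_pos x
  have h1 := planeWeight_le_one x
  rw [Real.norm_of_nonneg (by positivity)]
  nlinarith

/-- The pairs `(∇ψ / w, c ψ / w)` for test functions `ψ ∈ C_c^∞(U)`. -/
noncomputable def testPairs (U : Set Plane) (c : Plane → ℝ) :
    Submodule ℝ (Lp Plane 2 (volume.restrict U) × Lp ℝ 2 (volume.restrict U)) where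
  carrier := {ξ | ∃ ψ : Plane → ℝ, ContDiff ℝ ∞ ψ ∧ HasCompactSupport ψ ∧ tsupport ψ ⊆ U ∧
    (∀ᵐ x ∂(volume.restrict U), ξ.1 x = (planeWeight x)⁻¹ • gradient ψ x) ∧
    ∀ᵐ x ∂(volume.restrict U), ξ.2 x = (planeWeight x)⁻¹ * (c x * ψ x)}
  zero_mem' := by
    refine ⟨0, contDiff_const, HasCompactSupport.zero, by simp [tsupport], ?_, ?_⟩
    · filter_upwards [Lp.coeFn_zero Plane 2 (volume.restrict U)] with x hx
      have : gradient (0 : Plane → ℝ) x = 0 :=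
        gradient_eq_zero_of_notMem_tsupport (by simp [tsupport])
      rw [this, smul_zero]
      exact hx
    · filter_upwards [Lp.coeFn_zero ℝ 2 (volume.restrict U)] with x hx
      rw [Pi.zero_apply, mul_zero, mul_zero]
      exact hx
  add_mem' := by
    rintro ξ η ⟨ψ, hψ1, hψ2, hψ3, hψ4, hψ5⟩ ⟨χ, hχ1, hχ2, hχ3, hχ4, hχ5⟩
    refine ⟨ψ + χ, hψ1.add hχ1, hψ2.add hχ2,
      (tsupport_add ψ χ).trans (union_subset hψ3 hχ3), ?_, ?_⟩
    · filter_upwards [hψ4, hχ4, Lp.coeFn_add ξ.1 η.1] with x h1 h2 h3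
      rw [gradient_add (hψ1.differentiable (by simp) x) (hχ1.differentiable (by simp) x),
        smul_add, ← h1, ← h2]
      exact h3
    · filter_upwards [hψ5, hχ5, Lp.coeFn_add ξ.2 η.2] with x h1 h2 h3
      rw [Pi.add_apply, mul_add, mul_add, ← h1, ← h2]
      exact h3
  smul_mem' := by
    rintro a ξ ⟨ψ, hψ1, hψ2, hψ3, hψ4, hψ5⟩
    have hsub : tsupport (a • ψ) ⊆ tsupport ψ := tsupport_smul_subset_right (fun _ => a) ψ
    refine ⟨a • ψ, contDiff_const.smul hψ1, hψ2.of_isClosed_subset (isClosed_tsupport _) hsub,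
      hsub.trans hψ3, ?_, ?_⟩
    · filter_upwards [hψ4, Lp.coeFn_smul a ξ.1] with x h1 h3
      rw [gradient_const_smul (hψ1.differentiable (by simp) x), smul_comm, ← h1]
      exact h3
    · filter_upwards [hψ5, Lp.coeFn_smul a ξ.2] with x h1 h3
      rw [Pi.smul_apply, smul_eq_mul, mul_left_comm (c x), mul_left_comm _ a, ← h1]
      exact h3

theorem memLp_two_gradient_div {U : Set Plane} {ψ : Plane → ℝ} (hψ : ContDiff ℝ ∞ ψ)
    (hψc : HasCompactSupport ψ) :
    MemLp (fun x => (planeWeight x)⁻¹ • gradient ψ x) 2 (volume.restrict U) := by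
  have hg : Continuous (gradient ψ) :=
    (InnerProductSpace.toDual ℝ Plane).symm.continuous.comp (hψ.continuous_fderiv (by simp))
  have hw : Continuous fun x => (planeWeight x)⁻¹ :=
    continuous_planeWeight.inv₀ fun x => (planeWeight_pos x).ne'
  refine MemLp.restrict U ((hw.smul hg).memLp_of_hasCompactSupport ?_)
  refine HasCompactSupport.intro hψc fun x hx => ?_
  change (planeWeight x)⁻¹ • gradient ψ x = 0
  rw [gradient_eq_zero_of_notMem_tsupport hx, smul_zero]

theorem memLp_two_mul_div {U : Set Plane} {c : Plane → ℝ} (hc : ContinuousOn c U)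
    (hcm : Measurable c) {ψ : Plane → ℝ} (hψ : Continuous ψ) (hψc : HasCompactSupport ψ)
    (hsupp : tsupport ψ ⊆ U) :
    MemLp (fun x => (planeWeight x)⁻¹ * (c x * ψ x)) 2 (volume.restrict U) := by
  refine MemLp.restrict U ?_
  have hw : Continuous fun x => (planeWeight x)⁻¹ :=
    continuous_planeWeight.inv₀ fun x => (planeWeight_pos x).ne'
  have hm : Measurable fun x => (planeWeight x)⁻¹ * (c x * ψ x) :=
    hw.measurable.mul (hcm.mul hψ.measurable)
  rw [memLp_two_iff_integrable_sq hm.aestronglyMeasurable]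
  have := integrable_mul_of_tsupport_subset hψ hψc hsupp
    (c := fun x => ψ x * ((planeWeight x)⁻¹ * c x) ^ 2)
    (hψ.continuousOn.mul ((hw.continuousOn.mul hc).pow 2))
  refine this.congr (Eventually.of_forall fun x => ?_)
  change ψ x * (ψ x * ((planeWeight x)⁻¹ * c x) ^ 2) = ((planeWeight x)⁻¹ * (c x * ψ x)) ^ 2
  ring

theorem corollary2p6 (φ : Plane → ℝ) (hφ : IsAnisotropy φ) (E : Set Plane) (R : ℝ) (hR : 0 < R)
    (hE : WulffCondition φ R E) :
    ∃ n : Plane → Plane, IsCahnHoffmanFieldOn φ E (tube φ E R) n ∧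
      ∃ g : Plane → ℝ, HasWeakDivOn n g (tube φ E R) ∧ MemLinftyLoc g (tube φ E R) := by
  obtain ⟨hin, hout⟩ := hE
  change InnerWulffCondition φ R Eᶜ at hout
  have hin' : InnerWulffCondition φ R Eᶜᶜ := by rwa [compl_compl]
  have hE : E.Nonempty := hout.nonempty_of_compl hφ hR
  have hE' : Eᶜ.Nonempty := hin'.nonempty_of_compl hφ hR
  have hE'' : Eᶜᶜ.Nonempty := by rwa [compl_compl]
  set d := phiSignedDist φ E with hd
  have hdle : ∀ x y, d x ≤ d y + φ (x - y) := hφ.phiSignedDist_le_add hE hE'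
  have hA : ∀ x, -R < d x → ∃ z, d z ≤ -R ∧ φ (x - z) ≤ R + d x := fun x hx =>
    hφ.exists_center_of_lt hR hE hE' hin hout hx
  have hA' : ∀ x, d x < R → ∃ z, R ≤ d z ∧ φ (x - z) ≤ R - d x := fun x hx => by
    have hcompl : ∀ y, phiSignedDist φ Eᶜ y = -d y := hφ.phiSignedDist_compl E
    obtain ⟨z, hz1, hz2⟩ := hφ.exists_center_of_lt hR hE' hE'' hout hin' (x := x)
      (by rw [hcompl]; linarith)
    rw [hcompl] at hz1 hz2
    exact ⟨z, by linarith, by linarith⟩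
  obtain ⟨Kd, hdL⟩ := hφ.lipschitz_of_le_add hdle
  have hdc := hdL.continuous
  set U := tube φ E R with hU
  have hUd : ∀ x ∈ U, |d x| < R := fun x hx => hx
  have hUo : IsOpen U := isOpen_lt hdc.abs continuous_const
  have hUm := hUo.measurableSet
  set μ := (volume : Measure Plane).restrict U with hμ
  set w := planeWeight with hw
  have hw0 := planeWeight_pos
  have hwm : Measurable w := continuous_planeWeight.measurable
  -- The bound from the two-sided inequality; it blows up at the edge of the tube, so the divergence
  -- is bounded only locally.
  set c : Plane → ℝ := fun x => (R - |d x|)⁻¹ with hc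
  have hcU : ContinuousOn c U :=
    ContinuousOn.inv₀ (f := fun x => R - |d x|) (continuous_const.sub hdc.abs).continuousOn
      fun x hx => by linarith [hUd x hx]
  have hcm : Measurable c := (measurable_const.sub hdc.abs.measurable).inv
  have hc0 : ∀ x ∈ U, 0 ≤ c x := fun x hx => inv_nonneg.2 (by linarith [hUd x hx])
  have hDm := measurable_gradient d
  obtain ⟨n₀, g₀, hV, hn₀, hg₀⟩ := hφ.exists_calibration (μ := μ) hDm hwm hw0
    integrable_planeWeight.integrableOn (memLp_two_planeWeight.restrict U) (testPairs U c) (by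
      rintro ξ ⟨ψ, hψ, hψc, hψU, h1, h2⟩
      have hzero : ∀ x, x ∉ U → ψ x = 0 := fun x hx => by
        by_contra h
        exact hx (hψU (subset_tsupport ψ h))
      have e1 : ∫ x, w x * (polarAnisotropy φ (gradient d x + ξ.1 x)
          - polarAnisotropy φ (gradient d x)) ∂μ = ∫ x, w x *
          (polarAnisotropy φ (gradient d x + (w x)⁻¹ • gradient ψ x)
          - polarAnisotropy φ (gradient d x)) := by
        rw [← setIntegral_eq_integral_of_forall_compl_eq_zero (μ := volume) (s := U)]
        · refine integral_congr_ae ?_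
          filter_upwards [h1] with x hx
          rw [hx]
        · intro x hx
          rw [gradient_eq_zero_of_notMem_tsupport fun h => hx (hψU h)]
          simp
      have e2 : ∫ x, w x * ‖ξ.2 x‖ ∂μ = ∫ x, |ψ x| * (R - |d x|)⁻¹ := by
        rw [← setIntegral_eq_integral_of_forall_compl_eq_zero (μ := volume) (s := U)]
        · refine integral_congr_ae ?_
          filter_upwards [h2, ae_restrict_mem hUm] with x hx hxU
          rw [hx, norm_mul, norm_mul, norm_inv, Real.norm_of_nonneg (hw0 x).le,
            Real.norm_of_nonneg (hc0 x hxU), mul_inv_cancel_left₀ (hw0 x).ne', mul_comm]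
          rfl
        · intro x hx
          rw [hzero x hx]
          simp
      rw [e1, e2]
      exact hφ.integral_polar_sub_add_nonneg hdle hA hA' hwm hw0 planeWeight_le_one hψ hψc hψU)
  obtain ⟨B, hB, -, hPB⟩ := hφ.exists_polar_bound
  -- Undoing the weights of the test pairs turns orthogonality to `testPairs U c` into the
  -- divergence identity.
  set n : Plane → Plane := fun x => (w x)⁻¹ • n₀ x with hn
  set g : Plane → ℝ := fun x => (w x)⁻¹ * (c x * g₀ x) with hg
  have hnm : AEStronglyMeasurable n μ :=
    hwm.inv.aestronglyMeasurable.smul (Lp.aestronglyMeasurable n₀)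
  have hgm : AEStronglyMeasurable g μ :=
    hwm.inv.aestronglyMeasurable.mul (hcm.aestronglyMeasurable.mul (Lp.aestronglyMeasurable g₀))
  have hnsub : ∀ᵐ x ∂μ, ∀ v, ⟪n x, v⟫ ≤
      polarAnisotropy φ (gradient d x + v) - polarAnisotropy φ (gradient d x) := by
    filter_upwards [hn₀] with x hx v
    change ⟪(w x)⁻¹ • n₀ x, v⟫ ≤ _
    rw [real_inner_smul_left, inv_mul_le_iff₀ (hw0 x)]
    exact hx v
  have hnB : ∀ᵐ x ∂μ, ‖n x‖ ≤ B := by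
    filter_upwards [hnsub] with x hx
    -- The subgradient inequality with `v = n x` gives `‖n x‖² ≤ B ‖n x‖`.
    have h1 := (hx (n x)).trans ((le_abs_self _).trans (hPB _ _))
    rw [add_sub_cancel_left, real_inner_self_eq_norm_mul_norm] at h1
    by_contra h
    push Not at h
    nlinarith
  have hnLp : MemLp n ⊤ μ := memLp_top_of_bound hnm B hnB
  have hgc : ∀ᵐ x ∂μ, |g x| ≤ c x := by
    filter_upwards [hg₀, ae_restrict_mem hUm] with x hx hxU
    change |(w x)⁻¹ * (c x * g₀ x)| ≤ _
    rw [abs_mul, abs_mul, abs_of_nonneg (inv_nonneg.2 (hw0 x).le), abs_of_nonneg (hc0 x hxU),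
      inv_mul_le_iff₀ (hw0 x), mul_comm (w x)]
    exact mul_le_mul_of_nonneg_left hx (hc0 x hxU)
  have hgLp : MemLinftyLoc g U := by
    intro K hK hKU
    obtain ⟨M, hM⟩ := hK.exists_bound_of_continuousOn (hcU.mono hKU)
    refine memLp_top_of_bound (hgm.mono_measure (Measure.restrict_mono hKU le_rfl)) M ?_
    filter_upwards [ae_restrict_of_ae_restrict_of_subset hKU hgc,
      ae_restrict_mem hK.measurableSet] with x hx hxK
    exact hx.trans ((le_abs_self _).trans (hM x hxK))
  refine ⟨n, ⟨hnLp, ?_⟩, g, ⟨?_, ?_, ?_⟩, hgLp⟩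
  · filter_upwards [hnsub, ae_restrict_of_ae (hdL.ae_differentiableAt (μ := volume))] with x hx hxd
    refine ⟨hxd, fun y => ?_⟩
    have := hx (y - gradient d x)
    rw [add_sub_cancel] at this
    linarith
  · rw [locallyIntegrableOn_iff hUo.isLocallyClosed]
    intro K hKU hK
    have : IsFiniteMeasure ((volume : Measure Plane).restrict K) := ⟨by
      rw [Measure.restrict_apply_univ]; exact hK.measure_lt_top⟩
    exact (hnLp.mono_measure (Measure.restrict_mono hKU le_rfl)).integrable le_top
  · rw [locallyIntegrableOn_iff hUo.isLocallyClosed]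
    intro K hKU hK
    have : IsFiniteMeasure ((volume : Measure Plane).restrict K) := ⟨by
      rw [Measure.restrict_apply_univ]; exact hK.measure_lt_top⟩
    exact (hgLp K hK hKU).integrable le_top
  · intro ψ hψ hψc hψU
    have hm1 := memLp_two_gradient_div (U := U) hψ hψc
    have hm2 := memLp_two_mul_div hcU hcm hψ.continuous hψc hψU
    have h := hV (hm1.toLp _, hm2.toLp _) ⟨ψ, hψ, hψc, hψU, hm1.coeFn_toLp, hm2.coeFn_toLp⟩
    have e1 : ∫ x, ⟪n₀ x, hm1.toLp _ x⟫ ∂μ = ∫ x in U, ⟪n x, gradient ψ x⟫ := by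
      refine integral_congr_ae ?_
      filter_upwards [hm1.coeFn_toLp] with x hx
      rw [hx]
      change _ = ⟪(w x)⁻¹ • n₀ x, gradient ψ x⟫
      rw [real_inner_smul_left, real_inner_smul_right]
    have e2 : ∫ x, ⟪g₀ x, hm2.toLp _ x⟫ ∂μ = ∫ x in U, g x * ψ x := by
      refine integral_congr_ae ?_
      filter_upwards [hm2.coeFn_toLp] with x hx
      rw [hx]
      change (w x)⁻¹ * (c x * ψ x) * g₀ x = (w x)⁻¹ * (c x * g₀ x) * ψ x
      ring
    simp only [] at h
    rw [e1, e2] at h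
    linarith
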